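/- Let $e_1,e_2,e_3\in\mathbb C$ be pairwise distinct, $\bar e=\frac13(e_1+e_2+e_3)$, and let $E$ be the elliptic curve $y^2=4(x-e_1)(x-e_2)(x-e_3)$, completed by one point $\infty$, with involution $(x,y)^*=(x,-y)$. Its branch points are $\infty$, $(e_1,0)$, $(e_2,0)$, $(e_3,0)$. Let $u=u(P)=\int_\infty^P dx/y$ be the (multivalued) Abel map. Let $\omega_1,\omega_2$ be a basis, with $\operatorname{Im}(\omega_2/\omega_1)>0$, of the lattice $\Lambda=\mathbb Z\omega_1+\mathbb Z\omega_2$ of $E$, that is, $4(x-e_1)(x-e_2)(x-e_3)=4(x-\bar e)^3-g_2(\Lambda)(x-\bar e)-g_3(\Lambda)$ for all $x$. Let $\sigma,\zeta$ be the Weierstrass functions of $\Lambda$, $\eta_i=2\zeta(\omega_i/2)$ (so that $\zeta(u+\omega_i)=\zeta(u)+\eta_i$), $\Omega=\omega_2/\omega_1$, and for $p,q\in\mathbb C$ put $$\theta[p,q](z;\Omega)=\sum_{n\in\mathbb Z}e^{\pi i(n+p)^2\Omega+2\pi i(n+p)(z+q)},\qquad \sigma[p,q](u)=\exp\Big(\frac{\eta_1}{2\omega_1}u^2\Big)\frac{\omega_1}{\theta_{11}'}\,\theta[p,q]\Big(\frac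 u{\omega_1};\Omega\Big),$$ where $\theta_{11}'=\frac{d}{dz}\theta[\frac12,\frac12](z;\Omega)\big|_{z=0}$. Let $t\in\mathbb C$, $a\in\mathbb C\setminus\{e_1,e_2,e_3\}$, let $\alpha$ be a value of $u$ at a point of $E$ above $a$, let $P_\varphi,P_\psi\in E$, let $u_\varphi,u_\psi$ be values of $u$ at these points, and put $$\Phi(P)=\begin{pmatrix}\varphi(P)&\varphi(P^*)\\ \psi(P)&\psi(P^*)\end{pmatrix},\qquad \varphi(P)=\sigma[p,q](u+u_\varphi+t)\,\sigma(u-u_\varphi)\,e^{-\frac t2\{\zeta(u-\alpha)+\zeta(u+\alpha)\}},$$ and $\psi$ likewise with $u_\psi$ in place of $u_\varphi$; here $u(P^*)=-u(P)$, so $\Phi$ is a function of $u$. A cycle means a closed $C^1$ path on $E$ that avoids the branch points. Then: 1. The integrals of $dx/y$ along the cycles that avoid the points above $a$ are exactly the elements of $\Lambda$. 2. $\Phi$, as a function of $u$, is holomorphic at every value of the Abel map at a point of $E$ that does not lie above $a$. 3. Let $\gamma,\delta$ be cycles that avoid the points above $a$, with $\int_\gamma dx/y=\omega_1$ and $\int_\delta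 dx/y=\omega_2$. For each holomorphic branch of $u$ at the initial point of the cycle, the germ of $\Phi$ can be continued analytically along the cycle, and the results are $$T_\gamma[\Phi(P)]=\Phi(P)\begin{pmatrix}e^{\pi i(2p+1)}&0\\0&e^{-\pi i(2p+1)}\end{pmatrix}e^{\eta_1(2u+\omega_1)},\qquad T_\delta[\Phi(P)]=\Phi(P)\begin{pmatrix}e^{-\pi i(2q+1)}&0\\0&e^{\pi i(2q+1)}\end{pmatrix}e^{\eta_2(2u+\omega_2)}.$$ 4. $\det\Phi$ is not identically zero if and only if $P_\varphi\ne P_\psi$, $\sigma[p,q](t)\neq0$ and $\sigma[p,q](u_\varphi+u_\psi+t)\ne0$. 5. In that case $\Phi(P)$ is invertible at every value of $u$ at every point $P$ of $E$ that is neither a branch point nor above $a$. Moreover $\det\Phi$ extends to an entire function of $u$ whose zero set on $E$ consists of exactly four points, the branch points $\infty,e_1,e_2,e_3$; all the zeros are simple, and the extension does not vanish at the points above $a$. -/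

import Mathlib

open Set Filter Topology

noncomputable section

namespace EllipticRH

/-! ### The elliptic curve and the Abel map -/

/-- The affine curve `y² = 4 (x - e₁)(x - e₂)(x - e₃)`. -/
abbrev AffineCurve (e : Fin 3 → ℂ) : Type :=
  {Q : ℂ × ℂ // Q.2 ^ 2 = 4 * ∏ i, (Q.1 - e i)}

/-- The projective curve `E`: the affine curve is closed in `ℂ²` and `E` has exactly one more point,
so that `E` is the one-point compactification of the affine curve. -/
abbrev Curve (e : Fin 3 → ℂ) : Type := OnePoint (AffineCurve e)

/-- The branch points `∞, e₁, e₂, e₃` of `x : E → ℙ¹`, as points of `E`. -/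
def branchPoints (e : Fin 3 → ℂ) : Set (Curve e) :=
  {P | P = OnePoint.infty ∨ ∃ Q : AffineCurve e, P = (Q : Curve e) ∧ ∃ i, Q.1 = (e i, 0)}

/-- `P` is one of the points of `E` above `a ∈ ℂ`. -/
def LiesOver {e : Fin 3 → ℂ} (P : Curve e) (a : ℂ) : Prop :=
  ∃ Q : AffineCurve e, P = (Q : Curve e) ∧ Q.1.1 = a

/-- The integral of `dx / y` along the part of the path `c` between the times `r₁` and `r₂`. -/
def abelIntegral {e : Fin 3 → ℂ} (c : ℝ → AffineCurve e) (r₁ r₂ : ℝ) : ℂ :=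
  ∫ s in r₁..r₂, deriv (fun s => (c s).1.1) s / (c s).1.2

/-- `u` is one of the values at `P ∈ E` of the (multivalued) Abel map `u = ∫_∞^P dx / y`:
some path on `E` from `∞` to `P`, of class `C¹` and without branch points between its two ends,
has the (improper) integral `u`. -/
def IsAbelValue (e : Fin 3 → ℂ) (P : Curve e) (u : ℂ) : Prop :=
  ∃ c : ℝ → AffineCurve e,
    ContinuousOn c (Ioo 0 1) ∧
    ContDiffOn ℝ 1 (fun s => (c s).1.1) (Ioo 0 1) ∧
    (∀ s ∈ Ioo (0 : ℝ) 1, (c s).1.2 ≠ 0) ∧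
    Tendsto (fun s => (c s : Curve e)) (𝓝[>] 0) (𝓝 OnePoint.infty) ∧
    Tendsto (fun s => (c s : Curve e)) (𝓝[<] 1) (𝓝 P) ∧
    Tendsto (fun r : ℝ × ℝ => abelIntegral c r.1 r.2) (𝓝[>] 0 ×ˢ 𝓝[<] 1) (𝓝 u)

/-- A closed path on `E`, of class `C¹`, that avoids the branch points. -/
def IsCycle {e : Fin 3 → ℂ} (c : ℝ → AffineCurve e) : Prop :=
  ContinuousOn c (Icc 0 1) ∧
  ContDiffOn ℝ 1 (fun s => (c s).1.1) (Icc 0 1) ∧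
  (∀ s ∈ Icc (0 : ℝ) 1, (c s).1.2 ≠ 0) ∧
  c 0 = c 1

/-- A holomorphic branch `w`, near the point `Q` of `E` and as a function of the coordinate `x`,
of the Abel map. -/
def IsAbelBranch (e : Fin 3 → ℂ) (Q : AffineCurve e) (w : ℂ → ℂ) : Prop :=
  AnalyticAt ℂ w Q.1.1 ∧
  IsAbelValue e (Q : Curve e) (w Q.1.1) ∧
  ∀ᶠ z in 𝓝 Q.1.1, ∃ R : AffineCurve e, R.1.1 = z ∧ IsAbelValue e (R : Curve e) (w z)

/-- `Λ = ℤ ω₁ + ℤ ω₂` is the lattice of `E`: in the shifted coordinate `x - (e₁ + e₂ + e₃) / 3` the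
equation of `E` is the Weierstrass equation `y² = 4 x³ - g₂(Λ) x - g₃(Λ)`. -/
def IsLatticeOf (L : PeriodPair) (e : Fin 3 → ℂ) : Prop :=
  ∀ x : ℂ, 4 * ∏ i, (x - e i) =
    4 * (x - (∑ i, e i) / 3) ^ 3 - L.g₂ * (x - (∑ i, e i) / 3) - L.g₃

/-! ### Analytic continuation of matrix-valued germs along a path of the `x`-plane -/

/-- The germ of `F` at `c 0` can be continued analytically along the path `c : [0, 1] → ℂ`, and the
result is the germ of `G` at `c 1`. -/
def ContinuesAlong (c : ℝ → ℂ) (F G : ℂ → Matrix (Fin 2) (Fin 2) ℂ) : Prop :=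
  ∃ f : ℝ → ℂ → Matrix (Fin 2) (Fin 2) ℂ,
    (∀ s ∈ Icc (0 : ℝ) 1, ∀ i j, AnalyticAt ℂ (fun z => f s z i j) (c s)) ∧
    (∀ s ∈ Icc (0 : ℝ) 1, ∀ᶠ r in 𝓝[Icc 0 1] s, f r =ᶠ[𝓝 (c r)] f s) ∧
    f 0 =ᶠ[𝓝 (c 0)] F ∧ f 1 =ᶠ[𝓝 (c 1)] G

/-! ### Sigma, zeta and theta functions -/

/-- The Weierstrass zeta function (the term of `l = 0` is `1 / z`, as `1 / 0 = 0`). -/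
def zeta (L : PeriodPair) (z : ℂ) : ℂ :=
  ∑' l : L.lattice, (1 / (z - l) + 1 / (l : ℂ) + z / (l : ℂ) ^ 2)

/-- The Weierstrass sigma function (the factor of `l = 0` is `1`, as `z / 0 = 0`). -/
def sigma (L : PeriodPair) (z : ℂ) : ℂ :=
  z * ∏' l : L.lattice, (1 - z / (l : ℂ)) * Complex.exp (z / (l : ℂ) + (z / (l : ℂ)) ^ 2 / 2)

/-- The quasi-period `η₁ = ζ(u + ω₁) - ζ(u) = 2 ζ(ω₁ / 2)`. -/
def eta₁ (L : PeriodPair) : ℂ := 2 * zeta L (L.ω₁ / 2)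

/-- The quasi-period `η₂ = ζ(u + ω₂) - ζ(u) = 2 ζ(ω₂ / 2)`. -/
def eta₂ (L : PeriodPair) : ℂ := 2 * zeta L (L.ω₂ / 2)

/-- The theta function `θ[p,q](z; Ω)` with characteristic. -/
def theta (p q z Ω : ℂ) : ℂ :=
  ∑' n : ℤ, Complex.exp (Real.pi * Complex.I * (n + p) ^ 2 * Ω +
    2 * Real.pi * Complex.I * (n + p) * (z + q))

/-- The number `θ₁₁' = θ₁₁'(0; Ω)`, where `θ₁₁ = θ[1/2,1/2]`. -/
def theta₁₁' (Ω : ℂ) : ℂ := deriv (fun z => theta (1 / 2) (1 / 2) z Ω) 0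

/-- The sigma function with characteristic,
`σ[p,q](u) = exp (η₁ u² / (2 ω₁)) (ω₁ / θ₁₁') θ[p,q](u / ω₁; Ω)` with `Ω = ω₂ / ω₁`. -/
def sigmaChar (L : PeriodPair) (p q u : ℂ) : ℂ :=
  Complex.exp (eta₁ L / (2 * L.ω₁) * u ^ 2) * (L.ω₁ / theta₁₁' (L.ω₂ / L.ω₁)) *
    theta p q (u / L.ω₁) (L.ω₂ / L.ω₁)

/-! ### The matrix `Φ` -/

/-- `φ` (for `v = u_φ`) and `ψ` (for `v = u_ψ`), as functions of `u`. -/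
def entry (L : PeriodPair) (p q t α v u : ℂ) : ℂ :=
  sigmaChar L p q (u + v + t) * sigma L (u - v) *
    Complex.exp (-(t / 2) * (zeta L (u - α) + zeta L (u + α)))

/-- The matrix `Φ(P)` as a function of `u = u(P)`. The involution `P = (x, y) ↦ P* = (x, -y)` changes
the sign of `dx / y`, so that it is `u ↦ -u`. -/
def Phi (L : PeriodPair) (p q t α uφ uψ u : ℂ) : Matrix (Fin 2) (Fin 2) ℂ :=
  !![entry L p q t α uφ u, entry L p q t α uφ (-u);
     entry L p q t α uψ u, entry L p q t α uψ (-u)]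

end EllipticRH

end

/-! The curve is uniformized by `toCurve`, `u ↦ (ē + ℘(u), ℘'(u))`, a continuous surjection whose
fibres are the cosets of `Λ` (`toCurve_eq_iff`, `exists_toCurve_eq`). Since `dx = ℘'(u) du` and `y =
℘'(u)`, the form `dx / y` pulls back to `du`. Hence `u` is a value of the Abel map at `P` exactly if
`toCurve` sends `u` to `P` (`isAbelValue_iff`). A cycle lifts to a path in the `u`-plane whose ends
differ by its integral, so the periods are the elements of `Λ` (`periods_eq`), and continuation
along a cycle of period `ω` is the substitution `u ↦ u + ω` (`continuesAlong_of_isCycle`).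

The monodromy thus reduces to quasi-periodicity of the entries of `Φ`. Under `u ↦ u + ω`, `σ` and
`σ[p,q]` acquire exponential factors and `ζ` an additive constant `η`. The exponential of the zeta
functions is designed to cancel the factor `exp(ηt)`, and the shifts by `u_φ` cancel between the two
sigma functions. Both rows therefore have the same multipliers (`entry_add`, `Phi_add`). For `ω₂`
the Legendre relation is needed, because `σ[p,q]` is normalized with `η₁` (`legendre`).

The determinant is computed in closed form (`det_Phi`): it equals `σ[p,q](t) σ[p,q](u_φ + u_ψ + t)
σ(u_φ - u_ψ) σ(2u)`. Since `ζ` is odd, the essential singularities cancel. As `σ[p,q]` is a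
translate of `σ` up to an exponential (`exists_sigmaChar_eq`), what remains is the four-term
relation for `σ` (`fourTerm_eq`). Its left side is odd in `u` and has the multipliers of `σ(2u)`. It
therefore vanishes where `2u ∈ Λ`, and the quotient by `σ(2u)` is entire and elliptic, hence
constant. The first three factors of the determinant are the genericity conditions, and `σ(2u)`
vanishes, simply, exactly at the half-periods, which lie above the branch points. -/

namespace EllipticRH

section WeierstrassFunctions

variable (L : PeriodPair)

/-! ### The Weierstrass zeta function -/

/-- The three fractions add up to `z² / (l² (z - l))`; the decay `‖l‖⁻³` is summable over a lattice
of rank two. -/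
lemma zetaTerm_bound (r : ℝ) (hr : 0 < r) (z : ℂ) (hz : ‖z‖ < r) (l : ℂ) (h : 2 * r ≤ ‖l‖) :
    ‖1 / (z - l) + 1 / l + z / l ^ 2‖ ≤ 2 * r ^ 2 * ‖l‖ ^ (-3 : ℝ) := by
  have hl : 0 < ‖l‖ := by linarith
  have hl0 : l ≠ 0 := norm_pos_iff.1 hl
  have h1 : ‖l‖ / 2 ≤ ‖z - l‖ := by
    have := norm_sub_norm_le l z
    rw [norm_sub_rev] at this
    linarith
  have hzl : z - l ≠ 0 := norm_pos_iff.1 (by linarith)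
  have : 1 / (z - l) + 1 / l + z / l ^ 2 = z ^ 2 / (l ^ 2 * (z - l)) := by
    field_simp
    ring
  rw [this, norm_div, norm_mul, norm_pow, norm_pow]
  calc ‖z‖ ^ 2 / (‖l‖ ^ 2 * ‖z - l‖) ≤ r ^ 2 / (‖l‖ ^ 2 * (‖l‖ / 2)) := by gcongr
    _ = 2 * r ^ 2 * (‖l‖ ^ 3)⁻¹ := by field_simp
    _ = _ := by rw [Real.rpow_neg hl.le]; norm_cast

/-- Convergence holds on all of `ℂ`, lattice points included: only the terms with `‖l‖ ≥ 2r` are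
estimated, and the finitely many others may take the default value of `1 / 0`. -/
lemma hasSumLocallyUniformly_zeta :
    HasSumLocallyUniformly
      (fun (l : L.lattice) (z : ℂ) ↦ 1 / (z - l) + 1 / (l : ℂ) + z / (l : ℂ) ^ 2) (zeta L) := by
  refine L.hasSumLocallyUniformly_aux (u := (2 * · ^ 2 * ‖·‖ ^ (-3 : ℝ))) _
    (fun _ _ ↦ (ZLattice.summable_norm_rpow _ _ (by simp; norm_num)).mul_left _) fun r hr ↦
    Filter.eventually_atTop.mpr ⟨2 * r, ?_⟩
  rintro _ h s hs l rfl
  exact zetaTerm_bound r hr s hs l h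

lemma sub_lattice_ne_zero {L : PeriodPair} {z : ℂ} (hz : z ∉ L.lattice) (l : L.lattice) :
    z - l ≠ 0 := fun h ↦ hz (by rw [sub_eq_zero.1 h]; exact l.2)

lemma isOpen_compl_lattice : IsOpen ((L.lattice : Set ℂ)ᶜ) :=
  L.isClosed_lattice.isOpen_compl

lemma countable_lattice : (L.lattice : Set ℂ).Countable := by
  have : Countable L.lattice := L.latticeEquivProd.toEquiv.countable_iff.2 inferInstance
  exact this

lemma dense_compl_lattice : Dense ((L.lattice : Set ℂ)ᶜ) :=
  (countable_lattice L).dense_compl ℝ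

lemma isPreconnected_compl_lattice : IsPreconnected ((L.lattice : Set ℂ)ᶜ) :=
  ((countable_lattice L).isPathConnected_compl_of_one_lt_rank (by simp)).isConnected.isPreconnected

lemma hasDerivAt_zetaTerm {z : ℂ} (hz : z ∉ L.lattice) (l : L.lattice) :
    HasDerivAt (fun z : ℂ ↦ 1 / (z - l) + 1 / (l : ℂ) + z / (l : ℂ) ^ 2)
      (-(1 / (z - l) ^ 2 - 1 / (l : ℂ) ^ 2)) z := by
  have h1 : HasDerivAt (fun z : ℂ ↦ (z - l)⁻¹) (-1 / (z - l) ^ 2) z :=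
    ((hasDerivAt_id z).sub_const _).inv (sub_lattice_ne_zero hz l)
  have h2 := (h1.add_const (1 / (l : ℂ))).add ((hasDerivAt_id z).div_const ((l : ℂ) ^ 2))
  convert! h2 using 1
  · ext x; simp
  · simp; ring

lemma differentiableOn_zeta : DifferentiableOn ℂ (zeta L) (L.lattice : Set ℂ)ᶜ :=
  (hasSumLocallyUniformly_zeta L).hasSumLocallyUniformlyOn.differentiableOn
    (.of_forall fun _ ↦ .fun_sum fun l _ _ hz ↦
      (hasDerivAt_zetaTerm L hz l).differentiableAt.differentiableWithinAt) (isOpen_compl_lattice L)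

lemma analyticAt_zeta {z : ℂ} (hz : z ∉ L.lattice) : AnalyticAt ℂ (zeta L) z :=
  (differentiableOn_zeta L).analyticAt ((isOpen_compl_lattice L).mem_nhds hz)

lemma deriv_zeta {z : ℂ} (hz : z ∉ L.lattice) : deriv (zeta L) z = -L.weierstrassP z := by
  have h1 := (hasSumLocallyUniformly_zeta L).tendstoLocallyUniformlyOn
    (s := (L.lattice : Set ℂ)ᶜ) |>.deriv
    (.of_forall fun _ ↦ .fun_sum fun l _ _ hz ↦
      (hasDerivAt_zetaTerm L hz l).differentiableAt.differentiableWithinAt) (isOpen_compl_lattice L)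
  have h2 := h1.tendsto_at hz
  have h3 : HasSum (fun l : L.lattice ↦ -(1 / (z - l) ^ 2 - 1 / (l : ℂ) ^ 2))
    (-L.weierstrassP z) := (L.hasSum_weierstrassP z).neg
  refine tendsto_nhds_unique h2 (h3.congr fun s ↦ ?_)
  simp only [Function.comp_apply]
  rw [deriv_fun_sum fun l _ ↦ (hasDerivAt_zetaTerm L hz l).differentiableAt]
  exact Finset.sum_congr rfl fun l _ ↦ (hasDerivAt_zetaTerm L hz l).deriv.symm

lemma hasDerivAt_zeta {z : ℂ} (hz : z ∉ L.lattice) :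
    HasDerivAt (zeta L) (-L.weierstrassP z) z := by
  rw [← deriv_zeta L hz]
  exact (analyticAt_zeta L hz).differentiableAt.hasDerivAt

lemma zeta_neg (z : ℂ) : zeta L (-z) = -zeta L z := by
  simp only [zeta]
  rw [← (Equiv.neg L.lattice).tsum_eq, ← tsum_neg]
  congr with l
  have : -z - -(l : ℂ) = -(z - l) := by ring
  simp only [Equiv.neg_apply, NegMemClass.coe_neg, this, one_div, inv_neg, even_two, Even.neg_pow]
  ring

lemma add_mem_lattice_iff {L : PeriodPair} {z ω : ℂ} (hω : ω ∈ L.lattice) :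
    z + ω ∈ L.lattice ↔ z ∈ L.lattice :=
  L.lattice.add_mem_iff_left hω

/-- `ζ' = -℘` is periodic, so `ζ(z + ω) - ζ(z)` is locally constant, and the complement of the
lattice is connected. -/
lemma exists_zeta_add {ω : ℂ} (hω : ω ∈ L.lattice) :
    ∃ η : ℂ, ∀ z, z ∉ L.lattice → zeta L (z + ω) = zeta L z + η := by
  obtain ⟨z₀, hz₀⟩ := (dense_compl_lattice L).nonempty
  have hd : ∀ z ∈ (L.lattice : Set ℂ)ᶜ,
      HasDerivAt (fun z ↦ zeta L (z + ω) - zeta L z) 0 z := by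
    intro z hz
    have h1 : z + ω ∉ L.lattice := fun h ↦ hz ((add_mem_lattice_iff hω).1 h)
    have h2 := ((hasDerivAt_zeta L h1).comp_add_const z ω).sub (hasDerivAt_zeta L hz)
    rw [L.weierstrassP_add_coe z ⟨ω, hω⟩, sub_self] at h2
    exact h2
  refine ⟨zeta L (z₀ + ω) - zeta L z₀, fun z hz ↦ ?_⟩
  have := (isOpen_compl_lattice L).is_const_of_deriv_eq_zero (isPreconnected_compl_lattice L)
    (fun z hz ↦ (hd z hz).differentiableAt.differentiableWithinAt)
    (fun z hz ↦ (hd z hz).deriv) hz hz₀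
  linear_combination this

lemma zeta_add_ω₁ {z : ℂ} (hz : z ∉ L.lattice) :
    zeta L (z + L.ω₁) = zeta L z + eta₁ L := by
  obtain ⟨η, h⟩ := exists_zeta_add L L.ω₁_mem_lattice
  -- At `-ω₁ / 2` the oddness of `ζ` identifies the constant as `2 ζ(ω₁ / 2)`.
  have h1 := h (-(L.ω₁ / 2)) (by simpa using L.ω₁_div_two_notMem_lattice)
  rw [zeta_neg, show -(L.ω₁ / 2) + L.ω₁ = L.ω₁ / 2 by ring] at h1
  rw [h z hz, eta₁]
  linear_combination -h1

lemma zeta_add_ω₂ {z : ℂ} (hz : z ∉ L.lattice) :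
    zeta L (z + L.ω₂) = zeta L z + eta₂ L := by
  obtain ⟨η, h⟩ := exists_zeta_add L L.ω₂_mem_lattice
  have h1 := h (-(L.ω₂ / 2)) (by simpa using L.ω₂_div_two_notMem_lattice)
  rw [zeta_neg, show -(L.ω₂ / 2) + L.ω₂ = L.ω₂ / 2 by ring] at h1
  rw [h z hz, eta₂]
  linear_combination -h1

/-! ### The Weierstrass sigma function -/

/-- The Weierstrass elementary factor of genus two. -/
noncomputable def primaryFactor (w : ℂ) : ℂ := (1 - w) * Complex.exp (w + w ^ 2 / 2)

@[simp] lemma primaryFactor_zero : primaryFactor 0 = 1 := by simp [primaryFactor]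

lemma primaryFactor_eq_zero_iff {w : ℂ} : primaryFactor w = 0 ↔ w = 1 := by
  simp [primaryFactor, sub_eq_zero, eq_comm (a := w)]

lemma differentiable_primaryFactor : Differentiable ℂ primaryFactor := by
  unfold primaryFactor
  fun_prop

/-- The elementary factor is the exponential of the remainder of the Taylor polynomial of degree two
of `log (1 - w)`. This remainder is cubic in `w`. -/
lemma norm_primaryFactor_sub_one_le {w : ℂ} (hw : ‖w‖ ≤ 1 / 2) :
    ‖primaryFactor w - 1‖ ≤ 2 * ‖w‖ ^ 3 := by
  have h1 : (1 - w) ≠ 0 := by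
    intro h
    rw [← sub_eq_zero.1 h] at hw
    norm_num at hw
  have h2 : primaryFactor w = Complex.exp (Complex.log (1 + -w) - Complex.logTaylor 3 (-w)) := by
    have : Complex.logTaylor 3 (-w) = -(w + w ^ 2 / 2) := by
      simp [Complex.logTaylor, Finset.sum_range_succ]
      ring
    rw [this, sub_neg_eq_add, Complex.exp_add, ← sub_eq_add_neg, Complex.exp_log h1, primaryFactor]
  have h3 := Complex.norm_log_sub_logTaylor_le 2 (z := -w) (by rw [norm_neg]; linarith)
  rw [norm_neg] at h3
  have h4 : ‖Complex.log (1 + -w) - Complex.logTaylor 3 (-w)‖ ≤ ‖w‖ ^ 3 := by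
    refine h3.trans ?_
    have : (1 - ‖w‖)⁻¹ ≤ 2 := by
      rw [inv_le_comm₀ (by linarith) (by norm_num)]
      linarith
    have h5 : 0 ≤ ‖w‖ ^ 3 := by positivity
    norm_num
    nlinarith
  rw [h2]
  refine (Complex.norm_exp_sub_one_le (h4.trans ?_)).trans (by linarith)
  calc ‖w‖ ^ 3 ≤ (1 / 2) ^ 3 := by gcongr
    _ ≤ 1 := by norm_num

lemma sigma_eq (z : ℂ) : sigma L z = z * ∏' l : L.lattice, primaryFactor (z / (l : ℂ)) := rfl

/-- Bounds for the factors of the sigma function, on a ball. -/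
lemma eventually_norm_primaryFactor_le (r : ℝ) :
    ∀ᶠ l : L.lattice in cofinite, ∀ z ∈ Metric.ball (0 : ℂ) r,
      ‖primaryFactor (z / (l : ℂ)) - 1‖ ≤ 2 * r ^ 3 * ‖l‖ ^ (-3 : ℝ) := by
  refine (isCompact_iff_finite.mp (isCompact_closedBall (0 : L.lattice) (2 * r))).subset ?_
  intro l hl
  simp only [Metric.mem_closedBall, dist_zero_right]
  contrapose! hl
  simp only [mem_compl_iff, mem_ofPred_eq, not_not]
  intro z hz
  have hz' : ‖z‖ < r := by simpa using hz
  have hr : 0 < r := (norm_nonneg z).trans_lt hz'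
  have hl' : 2 * r < ‖(l : ℂ)‖ := hl
  have hl0 : 0 < ‖(l : ℂ)‖ := by linarith
  have h1 : ‖z / (l : ℂ)‖ ≤ r / ‖(l : ℂ)‖ := by
    rw [norm_div]
    gcongr
  have h2 : r / ‖(l : ℂ)‖ ≤ 1 / 2 := by
    rw [div_le_div_iff₀ hl0 (by norm_num)]
    linarith
  calc _ ≤ 2 * ‖z / (l : ℂ)‖ ^ 3 := norm_primaryFactor_sub_one_le (h1.trans h2)
    _ ≤ 2 * (r / ‖(l : ℂ)‖) ^ 3 := by gcongr
    _ = 2 * r ^ 3 * (‖(l : ℂ)‖ ^ 3)⁻¹ := by field_simp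
    _ = _ := by rw [Real.rpow_neg (norm_nonneg _)]; norm_cast

lemma summable_bound (c : ℝ) : Summable fun l : L.lattice ↦ c * ‖l‖ ^ (-3 : ℝ) :=
  (ZLattice.summable_norm_rpow _ _ (by simp; norm_num)).mul_left _

lemma hasProdLocallyUniformlyOn_primaryFactor :
    HasProdLocallyUniformlyOn (fun (l : L.lattice) (z : ℂ) ↦ primaryFactor (z / (l : ℂ)))
      (fun z ↦ ∏' l : L.lattice, primaryFactor (z / (l : ℂ))) univ := by
  refine hasProdLocallyUniformlyOn_of_forall_compact isOpen_univ fun K _ hK ↦ ?_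
  obtain ⟨r, hr⟩ := hK.isBounded.subset_ball 0
  have := (summable_bound L (2 * r ^ 3)).hasProdUniformlyOn_one_add
    (f := fun (l : L.lattice) (z : ℂ) ↦ primaryFactor (z / (l : ℂ)) - 1) hK
    ((eventually_norm_primaryFactor_le L r).mono fun l hl z hz ↦ hl z (hr hz))
    (fun l ↦ Continuous.continuousOn (by
      have := differentiable_primaryFactor.continuous
      fun_prop))
  simpa using this

lemma differentiable_tprod_primaryFactor :
    Differentiable ℂ fun z ↦ ∏' l : L.lattice, primaryFactor (z / (l : ℂ)) := by
  rw [← differentiableOn_univ]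
  refine (hasProdLocallyUniformlyOn_primaryFactor L).differentiableOn
    (.of_forall fun s ↦ ?_) isOpen_univ
  refine Differentiable.differentiableOn (.fun_finsetProd fun l _ ↦ ?_)
  exact differentiable_primaryFactor.comp (by fun_prop)

lemma differentiable_sigma : Differentiable ℂ (sigma L) := by
  have := differentiable_tprod_primaryFactor L
  exact differentiable_id.mul this

@[simp] lemma sigma_zero : sigma L 0 = 0 := by simp [sigma]

lemma deriv_sigma_zero : deriv (sigma L) 0 = 1 := by
  have h := (hasDerivAt_id (0 : ℂ)).mul (differentiable_tprod_primaryFactor L 0).hasDerivAt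
  have h' : HasDerivAt (sigma L) _ 0 := h
  rw [h'.deriv]
  simp

lemma sigma_neg (z : ℂ) : sigma L (-z) = -sigma L z := by
  rw [sigma_eq, sigma_eq, ← (Equiv.neg L.lattice).tprod_eq, neg_mul]
  simp

lemma primaryFactor_div_ne_zero {z : ℂ} (hz : z ∉ L.lattice) (l : L.lattice) :
    primaryFactor (z / (l : ℂ)) ≠ 0 := by
  rw [Ne, primaryFactor_eq_zero_iff]
  intro h
  have : z = l := by
    rcases eq_or_ne (l : ℂ) 0 with h0 | h0
    · simp [h0] at h
    · exact (div_eq_one_iff_eq h0).1 h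
  exact hz (this ▸ l.2)

lemma tprod_primaryFactor_ne_zero {z : ℂ} (hz : z ∉ L.lattice) :
    ∏' l : L.lattice, primaryFactor (z / (l : ℂ)) ≠ 0 := by
  have := tprod_one_add_ne_zero_of_summable
    (f := fun l : L.lattice ↦ primaryFactor (z / (l : ℂ)) - 1)
    (fun l ↦ by simpa using primaryFactor_div_ne_zero L hz l)
    ((summable_bound L (2 * (‖z‖ + 1) ^ 3)).of_norm_bounded_eventually (by
      filter_upwards [eventually_norm_primaryFactor_le L (‖z‖ + 1)] with l hl
      simpa using hl z (by simp)))
  simpa using this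

lemma sigma_ne_zero {z : ℂ} (hz : z ∉ L.lattice) : sigma L z ≠ 0 :=
  mul_ne_zero (fun h ↦ hz (h ▸ L.lattice.zero_mem)) (tprod_primaryFactor_ne_zero L hz)

/-- The subtracted term accounts for `l = 0`: that factor is the constant `1`, while the
corresponding term of `ζ` is `1 / z`. The factor `z` in front of the product for `σ` restores it. -/
lemma logDeriv_primaryFactor {z : ℂ} (hz : z ∉ L.lattice) (l : L.lattice) :
    logDeriv (fun z ↦ primaryFactor (z / (l : ℂ))) z =
      (1 / (z - l) + 1 / (l : ℂ) + z / (l : ℂ) ^ 2) - if l = 0 then 1 / z else 0 := by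
  rcases eq_or_ne l 0 with rfl | hl
  · simp [logDeriv]
  have hl0 : (l : ℂ) ≠ 0 := by simpa using hl
  have hzl := sub_lattice_ne_zero hz l
  have hzl' : (l : ℂ) - z ≠ 0 := by rwa [← neg_sub, neg_ne_zero]
  have h1 : HasDerivAt (fun z : ℂ ↦ primaryFactor (z / (l : ℂ)))
      (-(1 / l) * Complex.exp (z / l + (z / l) ^ 2 / 2) + (1 - z / l) *
        (Complex.exp (z / l + (z / l) ^ 2 / 2) * (1 / l + (2 * (z / l) * (1 / l)) / 2))) z := by
    have h0 : HasDerivAt (fun z : ℂ ↦ z / (l : ℂ)) (1 / l) z := (hasDerivAt_id z).div_const _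
    have h2 := (h0.const_sub 1).mul ((h0.add ((h0.pow 2).div_const 2)).cexp)
    convert! h2 using 1
    simp
  rw [logDeriv_apply, h1.deriv, primaryFactor, if_neg hl]
  have := Complex.exp_ne_zero (z / l + (z / l) ^ 2 / 2)
  have h3 : 1 - z / (l : ℂ) ≠ 0 := by
    rw [one_sub_div hl0]
    exact div_ne_zero hzl' hl0
  rw [show (1 : ℂ) - z / l = -(z - l) / l by field_simp; ring, sub_zero]
  field_simp
  ring

lemma deriv_sigma {z : ℂ} (hz : z ∉ L.lattice) :
    deriv (sigma L) z = zeta L z * sigma L z := by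
  have hz0 : z ≠ 0 := fun h ↦ hz (h ▸ L.lattice.zero_mem)
  have hsum := (hasSumLocallyUniformly_zeta L).hasSum (x := z)
  have hite : HasSum (fun l : L.lattice ↦ if l = 0 then 1 / z else 0) (1 / z) :=
    hasSum_ite_eq 0 (1 / z)
  have hs := hsum.sub hite
  simp_rw [← logDeriv_primaryFactor L hz] at hs
  have h1 := logDeriv_tprod_eq_tsum (f := fun (l : L.lattice) (z : ℂ) ↦ primaryFactor (z / (l : ℂ)))
    isOpen_univ (mem_univ z)
    (primaryFactor_div_ne_zero L hz)
    (fun l ↦ (differentiable_primaryFactor.comp (by fun_prop)).differentiableOn)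
    hs.summable
    (hasProdLocallyUniformlyOn_primaryFactor L).multipliableLocallyUniformlyOn
    (tprod_primaryFactor_ne_zero L hz)
  rw [hs.tsum_eq, logDeriv_apply, div_eq_iff (tprod_primaryFactor_ne_zero L hz)] at h1
  have h := (hasDerivAt_id z).mul (differentiable_tprod_primaryFactor L z).hasDerivAt
  have h' : HasDerivAt (sigma L) _ z := h
  rw [h'.deriv, h1, sigma_eq]
  simp only [id]
  field_simp
  ring

lemma hasDerivAt_sigma {z : ℂ} (hz : z ∉ L.lattice) :
    HasDerivAt (sigma L) (zeta L z * sigma L z) z := by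
  rw [← deriv_sigma L hz]
  exact (differentiable_sigma L z).hasDerivAt

/-- The logarithmic derivative of `σ(z + ω) exp(-ηz) / σ(z)` is `ζ(z + ω) - η - ζ(z) = 0`, so this
function is constant off the lattice; continuity gives the relation everywhere. -/
lemma exists_sigma_add_of_zeta_add {ω η : ℂ} (hω : ω ∈ L.lattice)
    (hη : ∀ z, z ∉ L.lattice → zeta L (z + ω) = zeta L z + η) :
    ∃ κ : ℂ, ∀ z, sigma L (z + ω) = κ * Complex.exp (η * z) * sigma L z := by
  obtain ⟨z₀, hz₀⟩ := (dense_compl_lattice L).nonempty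
  set f : ℂ → ℂ := fun z ↦ sigma L (z + ω) * Complex.exp (-(η * z)) / sigma L z with hf
  have hd : ∀ z ∈ (L.lattice : Set ℂ)ᶜ, HasDerivAt f 0 z := by
    intro z hz
    have h1 : z + ω ∉ L.lattice := fun h ↦ hz ((add_mem_lattice_iff hω).1 h)
    have hE : HasDerivAt (fun z ↦ Complex.exp (-(η * z))) (Complex.exp (-(η * z)) * -η) z := by
      have := ((hasDerivAt_id z).const_mul η).neg.cexp
      simpa using this
    have h2 := (((hasDerivAt_sigma L h1).comp_add_const z ω).mul hE).div
      (hasDerivAt_sigma L hz) (sigma_ne_zero L hz)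
    convert! h2 using 1
    simp only [Pi.mul_apply]
    rw [hη z hz]
    field_simp [sigma_ne_zero L hz]
    ring
  refine ⟨f z₀, ?_⟩
  have key : ∀ z ∈ (L.lattice : Set ℂ)ᶜ,
      sigma L (z + ω) = f z₀ * Complex.exp (η * z) * sigma L z := by
    intro z hz
    have := (isOpen_compl_lattice L).is_const_of_deriv_eq_zero (isPreconnected_compl_lattice L)
      (fun z hz ↦ (hd z hz).differentiableAt.differentiableWithinAt)
      (fun z hz ↦ (hd z hz).deriv) hz hz₀
    rw [← this, hf]
    simp only [Complex.exp_neg]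
    field_simp [sigma_ne_zero L hz, Complex.exp_ne_zero (η * z)]
  have hc := (differentiable_sigma L).continuous
  have : (fun z ↦ sigma L (z + ω)) = fun z ↦ f z₀ * Complex.exp (η * z) * sigma L z :=
    Continuous.ext_on (dense_compl_lattice L) (by fun_prop) (by fun_prop) key
  exact congrFun this

lemma sigma_not_zero : ∃ z, sigma L z ≠ 0 :=
  ⟨_, sigma_ne_zero L L.ω₁_div_two_notMem_lattice⟩

/-- Applying the relation at `-z - ω` and using oddness determines `κ` up to sign. This is uniform
in `ω`, including `ω ∈ 2Λ`, and suffices wherever only even powers of `κ` or `κ ≠ 0` matter. -/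
lemma exists_sigma_add {ω : ℂ} (hω : ω ∈ L.lattice) :
    ∃ η κ : ℂ, κ ^ 2 = Complex.exp (η * ω) ∧
      ∀ z, sigma L (z + ω) = κ * Complex.exp (η * z) * sigma L z := by
  obtain ⟨η, hη⟩ := exists_zeta_add L hω
  obtain ⟨κ, hκ⟩ := exists_sigma_add_of_zeta_add L hω hη
  refine ⟨η, κ, ?_, hκ⟩
  obtain ⟨z, hz⟩ := sigma_not_zero L
  have h1 := hκ (-z - ω)
  rw [show -z - ω + ω = -z by ring, sigma_neg, show -z - ω = -(z + ω) by ring, sigma_neg,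
    hκ z] at h1
  have h2 : 1 = κ ^ 2 * (Complex.exp (η * -(z + ω)) * Complex.exp (η * z)) :=
    mul_right_cancel₀ hz (by linear_combination -h1)
  rw [← Complex.exp_add, show η * -(z + ω) + η * z = -(η * ω) by ring, Complex.exp_neg] at h2
  field_simp [Complex.exp_ne_zero] at h2
  exact h2.symm

lemma sigma_add_of_half_notMem {ω η : ℂ} (hω : ω ∈ L.lattice) (h2 : ω / 2 ∉ L.lattice)
    (hη : ∀ z, z ∉ L.lattice → zeta L (z + ω) = zeta L z + η) (z : ℂ) :
    sigma L (z + ω) = -Complex.exp (η * (z + ω / 2)) * sigma L z := by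
  obtain ⟨κ, hκ⟩ := exists_sigma_add_of_zeta_add L hω hη
  -- If `σ(ω / 2) ≠ 0`, evaluation at `-ω / 2` also fixes the sign: `κ = -exp(ηω / 2)`.
  have h1 := hκ (-(ω / 2))
  rw [sigma_neg, show -(ω / 2) + ω = ω / 2 by ring] at h1
  have h3 : 1 = -κ * Complex.exp (η * -(ω / 2)) :=
    mul_right_cancel₀ (sigma_ne_zero L h2) (by linear_combination h1)
  rw [mul_neg, Complex.exp_neg, ← div_eq_mul_inv, eq_div_iff (Complex.exp_ne_zero _), one_mul] at h3
  rw [hκ z, mul_add, Complex.exp_add, h3]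
  ring

lemma sigma_add_ω₁ (z : ℂ) :
    sigma L (z + L.ω₁) = -Complex.exp (eta₁ L * (z + L.ω₁ / 2)) * sigma L z :=
  sigma_add_of_half_notMem L L.ω₁_mem_lattice L.ω₁_div_two_notMem_lattice
    (fun _ ↦ zeta_add_ω₁ L) z

lemma sigma_add_ω₂ (z : ℂ) :
    sigma L (z + L.ω₂) = -Complex.exp (eta₂ L * (z + L.ω₂ / 2)) * sigma L z :=
  sigma_add_of_half_notMem L L.ω₂_mem_lattice L.ω₂_div_two_notMem_lattice
    (fun _ ↦ zeta_add_ω₂ L) z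

lemma sigma_eq_zero_iff {z : ℂ} : sigma L z = 0 ↔ z ∈ L.lattice := by
  refine ⟨fun h ↦ by_contra fun hz ↦ sigma_ne_zero L hz h, fun h ↦ ?_⟩
  obtain ⟨η, κ, -, hκ⟩ := exists_sigma_add L h
  simpa using hκ 0

/-- Quasi-periodicity transports `σ'(0) = 1` to every lattice point, with the nonzero factor `κ`. -/
lemma deriv_sigma_ne_zero {z : ℂ} (hz : z ∈ L.lattice) : deriv (sigma L) z ≠ 0 := by
  obtain ⟨η, κ, hκ2, hκ⟩ := exists_sigma_add L hz
  have h1 : HasDerivAt (fun w ↦ sigma L (w + z)) (deriv (sigma L) z) 0 := by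
    have := (differentiable_sigma L (0 + z)).hasDerivAt.comp_add_const 0 z
    simpa using this
  have h2 : HasDerivAt (fun w ↦ κ * Complex.exp (η * w) * sigma L w) κ 0 := by
    have h3 := (((hasDerivAt_id (0 : ℂ)).const_mul η).cexp.const_mul κ).mul
      (differentiable_sigma L 0).hasDerivAt
    convert! h3 using 1
    simp [deriv_sigma_zero]
  simp_rw [hκ] at h1
  rw [h1.unique h2]
  intro h0
  rw [h0] at hκ2
  exact Complex.exp_ne_zero _ (by rw [← hκ2]; simp)

end WeierstrassFunctions

section QuasiPeriods

/-! ### Entire functions -/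

lemma differentiable_dslope {f : ℂ → ℂ} (hf : Differentiable ℂ f) (c : ℂ) :
    Differentiable ℂ (dslope f c) := by
  rw [← differentiableOn_univ, Complex.differentiableOn_dslope univ_mem, differentiableOn_univ]
  exact hf

/-- The quotient of two entire functions is entire if the denominator has only simple zeros, which
are zeros of the numerator. -/
lemma exists_entire_quotient {f g : ℂ → ℂ} (hf : Differentiable ℂ f) (hg : Differentiable ℂ g)
    (hs : ∀ z, g z = 0 → deriv g z ≠ 0) (h0 : ∀ z, g z = 0 → f z = 0) :
    ∃ h : ℂ → ℂ, Differentiable ℂ h ∧ ∀ z, f z = h z * g z := by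
  classical
  refine ⟨fun z ↦ if g z = 0 then deriv f z / deriv g z else f z / g z, fun z₀ ↦ ?_, fun z ↦ ?_⟩
  · by_cases hz : g z₀ = 0
    · have hd0 : dslope g z₀ z₀ ≠ 0 := by simpa using hs z₀ hz
      have hd : DifferentiableAt ℂ (fun z ↦ dslope f z₀ z / dslope g z₀ z) z₀ :=
        (differentiable_dslope hf z₀ z₀).div (differentiable_dslope hg z₀ z₀) hd0
      refine hd.congr_of_eventuallyEq ?_
      filter_upwards [(differentiable_dslope hg z₀).continuous.continuousAt.eventually_ne hd0]
        with z hz1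
      rcases eq_or_ne z z₀ with rfl | hne
      · simp [hz]
      have hne' : z - z₀ ≠ 0 := sub_ne_zero.2 hne
      have e1 := sub_smul_dslope f z₀ z
      have e2 := sub_smul_dslope g z₀ z
      simp only [smul_eq_mul, hz, h0 z₀ hz, sub_zero] at e1 e2
      have : g z ≠ 0 := by
        rw [← e2]
        exact mul_ne_zero hne' hz1
      rw [if_neg this, ← e1, ← e2, mul_div_mul_left _ _ hne']
    · refine ((hf z₀).div (hg z₀) hz).congr_of_eventuallyEq ?_
      filter_upwards [hg.continuous.continuousAt.eventually_ne hz] with z hz1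
      simp [hz1]
  · by_cases hz : g z = 0
    · simp [hz, h0 z hz]
    · simp [hz]

/-- Liouville's theorem: a continuous doubly periodic function has compact range. -/
lemma eq_const_of_periodic (L : PeriodPair) {f : ℂ → ℂ} (hf : Differentiable ℂ f)
    (hp : ∀ z, ∀ ω ∈ L.lattice, f (z + ω) = f z) (z w : ℂ) : f z = f w :=
  hf.apply_eq_apply_of_bounded
    (IsZLattice.isCompact_range_of_periodic L.lattice f hf.continuous fun z ω hω ↦
      hp z ω hω).isBounded z w

/-- An entire function is bounded if it is periodic with period `1` in absolute value, and if
its absolute value does not grow when one goes away from the real line in steps of `Ω`. -/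
lemma isBounded_range_of_norm_add_le {g : ℂ → ℂ} (hg : Continuous g) {Ω : ℂ} (hΩ : 0 < Ω.im)
    (h1 : ∀ z, ‖g (z + 1)‖ = ‖g z‖)
    (h2 : ∀ z : ℂ, 0 ≤ z.im → ‖g (z + Ω)‖ ≤ ‖g z‖)
    (h3 : ∀ z : ℂ, z.im ≤ 0 → ‖g z‖ ≤ ‖g (z + Ω)‖) :
    Bornology.IsBounded (range g) := by
  have up : ∀ (n : ℕ) (z : ℂ), 0 ≤ z.im → ‖g (z + n * Ω)‖ ≤ ‖g z‖ := by
    intro n z hz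
    induction n with
    | zero => simp
    | succ n ih =>
      have : z + (n + 1 : ℕ) * Ω = z + n * Ω + Ω := by push_cast; ring
      rw [this]
      refine (h2 _ ?_).trans ih
      simp only [Complex.add_im, Complex.mul_im, Complex.natCast_re, Complex.natCast_im, zero_mul,
        add_zero]
      positivity
  have down : ∀ (n : ℕ) (z : ℂ), z.im ≤ Ω.im → ‖g (z - n * Ω)‖ ≤ ‖g z‖ := by
    intro n z hz
    induction n with
    | zero => simp
    | succ n ih =>
      have : z - (n : ℂ) * Ω = z - (n + 1 : ℕ) * Ω + Ω := by push_cast; ring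
      rw [this] at ih
      refine (h3 _ ?_).trans ih
      simp only [Complex.sub_im, Complex.mul_im, Complex.natCast_re, Complex.natCast_im, zero_mul,
        add_zero]
      push_cast
      nlinarith [mul_nonneg (Nat.cast_nonneg (α := ℝ) n) hΩ.le]
  have hper : Function.Periodic (fun z ↦ ‖g z‖) 1 := h1
  obtain ⟨M, hM⟩ := (isCompact_closedBall (0 : ℂ) (1 + Ω.im + |Ω.re|)).exists_bound_of_continuousOn
    hg.continuousOn
  refine (isBounded_iff_forall_norm_le).2 ⟨M, ?_⟩
  rintro _ ⟨z, rfl⟩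
  -- Subtracting `kΩ` moves `z` into the strip `0 ≤ Im w < Im Ω` without decreasing the absolute
  -- value of `g`; an integer translation then moves it into a compact set.
  set k : ℤ := ⌊z.im / Ω.im⌋ with hk
  have hk1 : (k : ℝ) * Ω.im ≤ z.im := (le_div_iff₀ hΩ).1 (Int.floor_le _)
  have hk2 : z.im < (k + 1) * Ω.im := (div_lt_iff₀ hΩ).1 (Int.lt_floor_add_one _)
  set w : ℂ := z - k * Ω with hw
  have hwim : w.im = z.im - k * Ω.im := by simp [hw]
  have hle : ‖g z‖ ≤ ‖g w‖ := by
    have hz : z = w + k * Ω := by rw [hw]; ring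
    rcases Int.eq_nat_or_neg k with ⟨n, hn | hn⟩
    · rw [hz, hn, Int.cast_natCast]
      exact up n w (by rw [hwim]; linarith)
    · rw [hz, hn, Int.cast_neg, Int.cast_natCast, neg_mul, ← sub_eq_add_neg]
      exact down n w (by rw [hwim]; linarith)
  refine hle.trans ?_
  have h4 : ‖g (w - ⌊w.re⌋ * 1)‖ = ‖g w‖ := hper.sub_int_mul_eq ⌊w.re⌋
  rw [← h4]
  refine hM _ ?_
  rw [mem_closedBall_zero_iff]
  refine (Complex.norm_le_abs_re_add_abs_im _).trans ?_
  have e1 : (w - ⌊w.re⌋ * 1).re = w.re - ⌊w.re⌋ := by simp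
  have e2 : (w - ⌊w.re⌋ * 1).im = w.im := by simp
  have f1 := Int.floor_le w.re
  have f2 := Int.lt_floor_add_one w.re
  rw [e1, e2, abs_of_nonneg (by linarith), abs_of_nonneg (by rw [hwim]; linarith), hwim]
  have := abs_nonneg Ω.re
  linarith

/-- Theta functions of degree `-m ≤ 0` are exponentials. -/
lemma exists_eq_const_mul_exp {f : ℂ → ℂ} (hf : Differentiable ℂ f) {Ω C : ℂ} (hΩ : 0 < Ω.im)
    (hC : C ≠ 0) {m : ℝ} (hm : 0 ≤ m) (h1 : ∀ z, f (z + 1) = f z)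
    (h2 : ∀ z, f (z + Ω) = C * Complex.exp (2 * Real.pi * Complex.I * m * z) * f z) :
    ∃ c b : ℂ, ∀ z, f z = c * Complex.exp (b * z) := by
  -- Multiplication by `exp(-iμz)` with real `μ` preserves the periodicity of the absolute value,
  -- and this `μ` makes the factor change by `1 / |C|` in absolute value under `z ↦ z + Ω`.
  set μ : ℝ := -Real.log ‖C‖ / Ω.im with hμ
  set g : ℂ → ℂ := fun z ↦ f z * Complex.exp (-(Complex.I * μ * z)) with hgdef
  have hg : Differentiable ℂ g := by
    unfold g
    fun_prop
  have hg1 : ∀ z, ‖g (z + 1)‖ = ‖g z‖ := by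
    intro z
    simp only [g, h1, norm_mul, Complex.norm_exp]
    congr 2
    simp
  have hg2 : ∀ z : ℂ, ‖g (z + Ω)‖ = Real.exp (-(2 * Real.pi * m * z.im)) * ‖g z‖ := by
    intro z
    have e1 : ‖Complex.exp (2 * Real.pi * Complex.I * m * z)‖ =
        Real.exp (-(2 * Real.pi * m * z.im)) := by
      rw [Complex.norm_exp]
      congr 1
      simp
    have e2 : ‖Complex.exp (-(Complex.I * μ * (z + Ω)))‖ =
        ‖C‖⁻¹ * ‖Complex.exp (-(Complex.I * μ * z))‖ := by
      rw [Complex.norm_exp, Complex.norm_exp]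
      have : (-(Complex.I * μ * (z + Ω))).re = -Real.log ‖C‖ + (-(Complex.I * μ * z)).re := by
        have : μ * Ω.im = -Real.log ‖C‖ := by rw [hμ]; field_simp
        rw [← this]
        simp
        ring
      rw [this, Real.exp_add, Real.exp_neg, Real.exp_log (norm_pos_iff.2 hC)]
    simp only [g, h2, norm_mul, e1, e2]
    field_simp [norm_ne_zero_iff.2 hC]
  have hb := isBounded_range_of_norm_add_le hg.continuous hΩ hg1
    (fun z hz ↦ by
      rw [hg2]
      refine mul_le_of_le_one_left (norm_nonneg _) (Real.exp_le_one_iff.2 ?_)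
      have := Real.pi_pos
      rw [neg_nonpos]
      positivity)
    (fun z hz ↦ by
      rw [hg2]
      refine le_mul_of_one_le_left (norm_nonneg _) (Real.one_le_exp_iff.2 ?_)
      have := Real.pi_pos
      rw [← mul_neg]
      have : 0 ≤ -z.im := by linarith
      positivity)
  refine ⟨g 0, Complex.I * μ, fun z ↦ ?_⟩
  rw [hg.apply_eq_apply_of_bounded hb 0 z, hgdef]
  simp only
  rw [mul_assoc, ← Complex.exp_add]
  simp

/-- The same for functions with multipliers of general form. -/
lemma exists_eq_const_mul_exp_sq (L : PeriodPair) (hIm : 0 < (L.ω₂ / L.ω₁).im) {F : ℂ → ℂ}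
    (hF : Differentiable ℂ F) {c₁ c₂ η₁ η₂ : ℂ} (hc₁ : c₁ ≠ 0) (hc₂ : c₂ ≠ 0) {m : ℝ} (hm : 0 ≤ m)
    (hη : η₁ * L.ω₂ - η₂ * L.ω₁ = -(2 * Real.pi * Complex.I * m))
    (h1 : ∀ z, F (z + L.ω₁) = c₁ * Complex.exp (η₁ * z) * F z)
    (h2 : ∀ z, F (z + L.ω₂) = c₂ * Complex.exp (η₂ * z) * F z) :
    ∃ c b : ℂ, ∀ z, F z = c * Complex.exp (η₁ / (2 * L.ω₁) * z ^ 2 + b * z) := by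
  have hω : L.ω₁ ≠ 0 := by
    intro h
    simp [h] at hIm
  set Ω := L.ω₂ / L.ω₁ with hΩdef
  have hΩ : L.ω₁ * Ω = L.ω₂ := by rw [hΩdef]; field_simp
  -- The Gaussian factor of `f` below removes the exponential multiplier for `ω₁`; `k` is chosen to
  -- remove the remaining constant, so that `f` has period `1`.
  obtain ⟨k, hk⟩ : ∃ k, Complex.exp k = Complex.exp (η₁ * L.ω₁ / 2) / c₁ :=
    ⟨_, Complex.exp_log (div_ne_zero (Complex.exp_ne_zero _) hc₁)⟩
  set f : ℂ → ℂ := fun z ↦ Complex.exp (-(η₁ * L.ω₁ * z ^ 2 / 2) + k * z) * F (L.ω₁ * z) with hf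
  obtain ⟨c, b, hcb⟩ := exists_eq_const_mul_exp (f := f) (Ω := Ω)
    (C := c₂ * Complex.exp (-(η₁ * L.ω₁ * Ω ^ 2 / 2) + k * Ω)) (by unfold f; fun_prop) hIm
    (mul_ne_zero hc₂ (Complex.exp_ne_zero _)) hm
    (fun z ↦ by
      simp only [f]
      rw [show L.ω₁ * (z + 1) = L.ω₁ * z + L.ω₁ by ring, h1]
      have : -(η₁ * L.ω₁ * (z + 1) ^ 2 / 2) + k * (z + 1) = (-(η₁ * L.ω₁ * z ^ 2 / 2) + k * z) +
        (k - η₁ * L.ω₁ / 2 - η₁ * (L.ω₁ * z)) := by ring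
      rw [this, Complex.exp_add, Complex.exp_sub, Complex.exp_sub, hk]
      field_simp [Complex.exp_ne_zero])
    (fun z ↦ by
      simp only [f]
      rw [show L.ω₁ * (z + Ω) = L.ω₁ * z + L.ω₂ by rw [← hΩ]; ring, h2]
      have : -(η₁ * L.ω₁ * (z + Ω) ^ 2 / 2) + k * (z + Ω) + η₂ * (L.ω₁ * z) =
          (-(η₁ * L.ω₁ * Ω ^ 2 / 2) + k * Ω) + 2 * Real.pi * Complex.I * m * z +
          (-(η₁ * L.ω₁ * z ^ 2 / 2) + k * z) := by
        rw [← hΩ] at hη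
        linear_combination (-z) * hη
      have h3 := congrArg Complex.exp this
      simp only [Complex.exp_add] at h3 ⊢
      linear_combination c₂ * F (L.ω₁ * z) * h3)
  refine ⟨c, b / L.ω₁ - k / L.ω₁, fun z ↦ ?_⟩
  have h3 := hcb (z / L.ω₁)
  simp only [f] at h3
  rw [mul_div_cancel₀ _ hω] at h3
  have h4 : Complex.exp (-(-(η₁ * L.ω₁ * (z / L.ω₁) ^ 2 / 2) + k * (z / L.ω₁))) *
      Complex.exp (-(η₁ * L.ω₁ * (z / L.ω₁) ^ 2 / 2) + k * (z / L.ω₁)) = 1 := by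
    rw [← Complex.exp_add]
    simp
  have h5 : Complex.exp (η₁ / (2 * L.ω₁) * z ^ 2 + (b / L.ω₁ - k / L.ω₁) * z) =
      Complex.exp (-(-(η₁ * L.ω₁ * (z / L.ω₁) ^ 2 / 2) + k * (z / L.ω₁))) *
        Complex.exp (b * (z / L.ω₁)) := by
    rw [← Complex.exp_add]
    congr 1
    field_simp
    ring
  rw [h5]
  linear_combination -F z * h4 +
    Complex.exp (-(-(η₁ * L.ω₁ * (z / L.ω₁) ^ 2 / 2) + k * (z / L.ω₁))) * h3

lemma eq_zero_of_exp_mul_eq {α K : ℂ} (h : ∀ u : ℂ, Complex.exp (α * u) = K) : α = 0 := by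
  have h1 : HasDerivAt (fun u : ℂ ↦ Complex.exp (α * u)) α 0 := by
    have := ((hasDerivAt_id (0 : ℂ)).const_mul α).cexp
    simpa using this
  simp_rw [h] at h1
  exact h1.unique (hasDerivAt_const _ _)

/-! ### The theta function -/

lemma integral_jacobiTheta₂_term (n : ℤ) (τ : ℂ) :
    ∫ x in (0 : ℝ)..1, jacobiTheta₂_term n x τ = if n = 0 then 1 else 0 := by
  split_ifs with hn
  · simp [jacobiTheta₂_term, hn]
  · have hc : (2 * Real.pi * Complex.I * n : ℂ) ≠ 0 := by
      have := Real.pi_ne_zero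
      simp [hn]
    simp only [jacobiTheta₂_term, Complex.exp_add]
    rw [intervalIntegral.integral_mul_const, integral_exp_mul_complex hc]
    have : Complex.exp (2 * Real.pi * Complex.I * n * (1 : ℝ)) = 1 := by
      rw [show (2 * Real.pi * Complex.I * n * (1 : ℝ) : ℂ) = n * (2 * Real.pi * Complex.I) by
        push_cast; ring]
      exact Complex.exp_int_mul_two_pi_mul_I n
    rw [this]
    simp

/-- The constant Fourier coefficient on `[0, 1]` is `1`. -/
lemma exists_jacobiTheta₂_ne_zero {τ : ℂ} (hτ : 0 < τ.im) : ∃ z, jacobiTheta₂ z τ ≠ 0 := by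
  by_contra! h
  have hnorm : ∀ (n : ℤ) (x : ℝ), ‖jacobiTheta₂_term n x τ‖ = ‖jacobiTheta₂_term n 0 τ‖ := by
    intro n x
    simp [norm_jacobiTheta₂_term]
  have hs : Summable fun n ↦ ‖jacobiTheta₂_term n 0 τ‖ :=
    ((summable_jacobiTheta₂_term_iff 0 τ).2 hτ).norm
  have h1 := intervalIntegral.hasSum_integral_of_dominated_convergence (a := 0) (b := 1)
    (μ := MeasureTheory.volume) (F := fun (n : ℤ) (x : ℝ) ↦ jacobiTheta₂_term n x τ)
    (f := fun x : ℝ ↦ jacobiTheta₂ x τ)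
    (fun n _ ↦ ‖jacobiTheta₂_term n 0 τ‖)
    (fun n ↦ Continuous.aestronglyMeasurable (by unfold jacobiTheta₂_term; fun_prop))
    (fun n ↦ .of_forall fun x _ ↦ (hnorm n x).le)
    (.of_forall fun x _ ↦ hs) intervalIntegrable_const
    (.of_forall fun x _ ↦ hasSum_jacobiTheta₂_term x hτ)
  simp only [integral_jacobiTheta₂_term, h, intervalIntegral.integral_zero] at h1
  exact one_ne_zero ((hasSum_ite_eq (0 : ℤ) (1 : ℂ)).unique h1)

/-- Evenness and the shifts by `1` and `τ` relate the value at `(1 + τ) / 2` to its own negative. -/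
lemma jacobiTheta₂_zero_of_half (τ : ℂ) : jacobiTheta₂ ((1 + τ) / 2) τ = 0 := by
  have h1 := jacobiTheta₂_add_left' ((1 - τ) / 2) τ
  have h2 := jacobiTheta₂_add_left (-((1 + τ) / 2)) τ
  rw [jacobiTheta₂_neg_left, show -((1 + τ) / 2) + 1 = (1 - τ) / 2 by ring] at h2
  rw [show (1 - τ) / 2 + τ = (1 + τ) / 2 by ring, h2,
    show -Real.pi * Complex.I * (τ + 2 * ((1 - τ) / 2)) = -(Real.pi * Complex.I) by ring,
    Complex.exp_neg, Complex.exp_pi_mul_I] at h1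
  have h3 : (2 : ℂ) * jacobiTheta₂ ((1 + τ) / 2) τ = 0 := by
    norm_num at h1
    linear_combination h1
  simpa using h3

/-- Expanding `(n + p)²` moves the characteristic into the argument, so that the quasi-periodicity
of `jacobiTheta₂` applies. -/
lemma theta_eq (p q z Ω : ℂ) : theta p q z Ω =
    Complex.exp (Real.pi * Complex.I * p ^ 2 * Ω + 2 * Real.pi * Complex.I * p * (z + q)) *
      jacobiTheta₂ (z + q + p * Ω) Ω := by
  rw [theta, jacobiTheta₂, ← tsum_mul_left]
  refine tsum_congr fun n ↦ ?_
  rw [jacobiTheta₂_term, ← Complex.exp_add]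
  congr 1
  ring

/-! ### The odd theta function and the Legendre relation -/

variable (L : PeriodPair)

lemma ω₁_ne_zero : L.ω₁ ≠ 0 := by
  intro h
  have := L.ω₁_div_two_notMem_lattice
  rw [h, zero_div] at this
  exact this L.lattice.zero_mem

/-- The theta function whose zeros are the points of the lattice. -/
noncomputable def oddTheta (u : ℂ) : ℂ :=
  jacobiTheta₂ (u / L.ω₁ + (1 + L.ω₂ / L.ω₁) / 2) (L.ω₂ / L.ω₁)

lemma oddTheta_add_ω₁ (u : ℂ) : oddTheta L (u + L.ω₁) = oddTheta L u := by
  have := ω₁_ne_zero L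
  rw [oddTheta, oddTheta, ← jacobiTheta₂_add_left (u / L.ω₁ + _)]
  congr 1
  field_simp
  ring

lemma oddTheta_add_ω₂ (u : ℂ) : oddTheta L (u + L.ω₂) =
    Complex.exp (-Real.pi * Complex.I * (1 + 2 * (L.ω₂ / L.ω₁) + 2 * (u / L.ω₁))) *
      oddTheta L u := by
  have h := jacobiTheta₂_add_left' (u / L.ω₁ + (1 + L.ω₂ / L.ω₁) / 2) (L.ω₂ / L.ω₁)
  rw [oddTheta, oddTheta]
  convert h using 2
  · ring
  · congr 1
    ring

lemma oddTheta_eq_zero {u : ℂ} (hu : u ∈ L.lattice) : oddTheta L u = 0 := by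
  have h0 : oddTheta L 0 = 0 := by
    rw [oddTheta, zero_div, zero_add]
    exact jacobiTheta₂_zero_of_half _
  -- The translations that preserve the zero set form a group, so it is enough to check the two
  -- generators of the lattice.
  let Z : AddSubgroup ℂ :=
    { carrier := {ω | ∀ u, oddTheta L (u + ω) = 0 ↔ oddTheta L u = 0}
      zero_mem' := by simp
      add_mem' := by
        intro a b ha hb u
        rw [← add_assoc, hb, ha]
      neg_mem' := by
        intro a ha u
        rw [← ha (u + -a), neg_add_cancel_right] }
  have hZ : u ∈ Z := by
    obtain ⟨m, n, rfl⟩ := PeriodPair.mem_lattice.1 hu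
    rw [← zsmul_eq_mul, ← zsmul_eq_mul]
    refine Z.add_mem (Z.zsmul_mem ?_ m) (Z.zsmul_mem ?_ n)
    · intro u
      rw [oddTheta_add_ω₁]
    · intro u
      rw [oddTheta_add_ω₂]
      simp [Complex.exp_ne_zero]
  have := hZ 0
  rw [zero_add] at this
  exact this.2 h0

variable {L} (hIm : 0 < (L.ω₂ / L.ω₁).im)
include hIm

lemma differentiable_oddTheta : Differentiable ℂ (oddTheta L) := by
  intro u
  have h := differentiableAt_jacobiTheta₂_fst (u / L.ω₁ + (1 + L.ω₂ / L.ω₁) / 2) hIm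
  exact h.comp u (f := fun u ↦ u / L.ω₁ + (1 + L.ω₂ / L.ω₁) / 2) (by fun_prop)

lemma exists_oddTheta_ne_zero : ∃ u, oddTheta L u ≠ 0 := by
  obtain ⟨z, hz⟩ := exists_jacobiTheta₂_ne_zero hIm
  refine ⟨(z - (1 + L.ω₂ / L.ω₁) / 2) * L.ω₁, ?_⟩
  rw [oddTheta, mul_div_cancel_right₀ _ (ω₁_ne_zero L)]
  simpa using hz

/-- The Legendre relation, and the expression of the theta function by the sigma function. -/
lemma legendre_and_oddTheta_eq :
    eta₁ L * L.ω₂ - eta₂ L * L.ω₁ = 2 * Real.pi * Complex.I ∧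
      ∃ c b : ℂ, c ≠ 0 ∧ ∀ u, oddTheta L u =
        c * Complex.exp (-(eta₁ L / (2 * L.ω₁)) * u ^ 2 + b * u) * sigma L u := by
  have hω := ω₁_ne_zero L
  have hpi : (2 * Real.pi * Complex.I : ℂ) ≠ 0 := Complex.two_pi_I_ne_zero
  -- The two ways to pass from `u` to `u + ω₁ + ω₂` give the same value of `σ`; this yields the
  -- Legendre relation up to an unknown integer `d`, the degree of `σ` as a theta function.
  obtain ⟨d, hd⟩ : ∃ d : ℤ, eta₁ L * L.ω₂ - eta₂ L * L.ω₁ = 2 * Real.pi * Complex.I * d := by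
    obtain ⟨u, hu⟩ := sigma_not_zero L
    have h1 := sigma_add_ω₁ L (u + L.ω₂)
    rw [add_right_comm, sigma_add_ω₂, sigma_add_ω₂, sigma_add_ω₁, ← mul_assoc, ← mul_assoc,
      neg_mul_neg, neg_mul_neg] at h1
    have h3 := mul_right_cancel₀ hu h1
    rw [← Complex.exp_add, ← Complex.exp_add, Complex.exp_eq_exp_iff_exists_int] at h3
    obtain ⟨n, hn⟩ := h3
    exact ⟨-n, by push_cast; linear_combination -hn⟩
  -- If `d ≤ 0`, then `σ` would be a constant times a zero-free exponential; `σ(0) = 0` would make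
  -- it vanish identically.
  have hd1 : 1 ≤ d := by
    by_contra! hlt
    obtain ⟨c, b, hcb⟩ := exists_eq_const_mul_exp_sq L hIm (differentiable_sigma L)
      (c₁ := -Complex.exp (eta₁ L * (L.ω₁ / 2))) (c₂ := -Complex.exp (eta₂ L * (L.ω₂ / 2)))
      (η₁ := eta₁ L) (η₂ := eta₂ L) (m := -d)
      (neg_ne_zero.2 (Complex.exp_ne_zero _)) (neg_ne_zero.2 (Complex.exp_ne_zero _))
      (by have : (d : ℝ) ≤ 0 := by exact_mod_cast Int.lt_add_one_iff.1 hlt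
          linarith)
      (by rw [hd]; push_cast; ring)
      (fun z ↦ by rw [sigma_add_ω₁, mul_add, Complex.exp_add]; ring)
      (fun z ↦ by rw [sigma_add_ω₂, mul_add, Complex.exp_add]; ring)
    obtain ⟨u, hu⟩ := sigma_not_zero L
    have hc := hcb 0
    simp only [sigma_zero] at hc
    rw [eq_comm, mul_eq_zero, or_iff_left (Complex.exp_ne_zero _)] at hc
    exact hu (by rw [hcb u, hc, zero_mul])
  -- The quotient `H` of the odd theta function by `σ` is entire and of degree `1 - d ≤ 0`, hence it
  -- is an exponential as well.
  obtain ⟨H, hH, hHeq⟩ := exists_entire_quotient (differentiable_oddTheta hIm)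
    (differentiable_sigma L) (fun z hz ↦ deriv_sigma_ne_zero L ((sigma_eq_zero_iff L).1 hz))
    (fun z hz ↦ oddTheta_eq_zero L ((sigma_eq_zero_iff L).1 hz))
  have ext : ∀ f g : ℂ → ℂ, Continuous f → Continuous g →
      (∀ z, f z * sigma L z = g z * sigma L z) → f = g := fun f g hf hg h ↦
    Continuous.ext_on (dense_compl_lattice L) hf hg
      fun z hz ↦ mul_right_cancel₀ (sigma_ne_zero L hz) (h z)
  have hHc := hH.continuous
  set k₁ := -Complex.exp (-(eta₁ L * (L.ω₁ / 2))) with hk₁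
  set k₂ := -Complex.exp (-(eta₂ L * (L.ω₂ / 2)) +
    -Real.pi * Complex.I * (1 + 2 * (L.ω₂ / L.ω₁))) with hk₂
  have hH1 : (fun z ↦ H (z + L.ω₁)) =
      fun z ↦ k₁ * Complex.exp (-eta₁ L * z) * H z := by
    refine ext _ _ (by fun_prop) (by fun_prop) fun z ↦ ?_
    have h1 := oddTheta_add_ω₁ L z
    rw [hHeq, hHeq, sigma_add_ω₁] at h1
    have h2 : Complex.exp (-(eta₁ L * (L.ω₁ / 2))) * Complex.exp (-eta₁ L * z) *
        Complex.exp (eta₁ L * (z + L.ω₁ / 2)) = 1 := by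
      rw [← Complex.exp_add, ← Complex.exp_add, Complex.exp_eq_one_iff]
      exact ⟨0, by push_cast; ring⟩
    rw [hk₁]
    linear_combination -H (z + L.ω₁) * sigma L z * h2 -
      Complex.exp (-(eta₁ L * (L.ω₁ / 2))) * Complex.exp (-eta₁ L * z) * h1
  have hH2 : (fun z ↦ H (z + L.ω₂)) =
      fun z ↦ k₂ * Complex.exp ((-eta₂ L - 2 * Real.pi * Complex.I / L.ω₁) * z) * H z := by
    refine ext _ _ (by fun_prop) (by fun_prop) fun z ↦ ?_
    have h1 := oddTheta_add_ω₂ L z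
    rw [hHeq, hHeq, sigma_add_ω₂] at h1
    have h2 : Complex.exp (-(eta₂ L * (L.ω₂ / 2)) + -Real.pi * Complex.I *
        (1 + 2 * (L.ω₂ / L.ω₁))) *
        Complex.exp ((-eta₂ L - 2 * Real.pi * Complex.I / L.ω₁) * z) *
        Complex.exp (eta₂ L * (z + L.ω₂ / 2)) =
        Complex.exp (-Real.pi * Complex.I * (1 + 2 * (L.ω₂ / L.ω₁) + 2 * (z / L.ω₁))) := by
      rw [← Complex.exp_add, ← Complex.exp_add]
      congr 1
      ring
    have h3 := Complex.exp_ne_zero (eta₂ L * (z + L.ω₂ / 2))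
    refine mul_left_cancel₀ h3 ?_
    rw [hk₂]
    linear_combination -h1 + H z * sigma L z * h2
  have hk₁0 : k₁ ≠ 0 := neg_ne_zero.2 (Complex.exp_ne_zero _)
  have hk₂0 : k₂ ≠ 0 := neg_ne_zero.2 (Complex.exp_ne_zero _)
  obtain ⟨c, b, hcb⟩ := exists_eq_const_mul_exp_sq L hIm hH
    (c₁ := k₁) (c₂ := k₂) (η₁ := -eta₁ L) (η₂ := -eta₂ L - 2 * Real.pi * Complex.I / L.ω₁)
    (m := d - 1) hk₁0 hk₂0
    (by have : (1 : ℝ) ≤ d := by exact_mod_cast hd1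
        linarith)
    (by push_cast
        field_simp
        linear_combination -hd) (congrFun hH1) (congrFun hH2)
  have hc : c ≠ 0 := by
    rintro rfl
    obtain ⟨u, hu⟩ := exists_oddTheta_ne_zero hIm
    exact hu (by rw [hHeq, hcb, zero_mul, zero_mul])
  -- Substituting the exponential for `H` in its relation for `ω₂` leaves an exponential in `u` that
  -- must be constant; this forces `d = 1`.
  have hα : 2 * Real.pi * Complex.I * (1 - d) / L.ω₁ = 0 := by
    refine eq_zero_of_exp_mul_eq (K := k₂ / Complex.exp (-eta₁ L / (2 * L.ω₁) * L.ω₂ ^ 2 + b * L.ω₂))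
      fun u ↦ ?_
    rw [eq_div_iff (Complex.exp_ne_zero _)]
    have h1 := congrFun hH2 u
    simp only [hcb] at h1
    have h2 : Complex.exp (-eta₁ L / (2 * L.ω₁) * (u + L.ω₂) ^ 2 + b * (u + L.ω₂)) =
        Complex.exp (2 * Real.pi * Complex.I * (1 - d) / L.ω₁ * u) *
        Complex.exp (-eta₁ L / (2 * L.ω₁) * L.ω₂ ^ 2 + b * L.ω₂) *
        Complex.exp ((-eta₂ L - 2 * Real.pi * Complex.I / L.ω₁) * u) *
        Complex.exp (-eta₁ L / (2 * L.ω₁) * u ^ 2 + b * u) := by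
      rw [← Complex.exp_add, ← Complex.exp_add, ← Complex.exp_add]
      congr 1
      field_simp
      linear_combination -2 * u * hd
    rw [h2] at h1
    have h3 := Complex.exp_ne_zero ((-eta₂ L - 2 * Real.pi * Complex.I / L.ω₁) * u)
    have h4 := Complex.exp_ne_zero (-eta₁ L / (2 * L.ω₁) * u ^ 2 + b * u)
    refine mul_right_cancel₀ (mul_ne_zero hc (mul_ne_zero h3 h4)) ?_
    linear_combination h1
  have hd' : (d : ℂ) = 1 := by
    rw [div_eq_zero_iff, or_iff_left hω, mul_eq_zero, or_iff_right hpi] at hα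
    linear_combination -hα
  refine ⟨by rw [hd, hd', mul_one], c, b, hc, fun u ↦ ?_⟩
  rw [hHeq, hcb, neg_div]

lemma legendre : eta₁ L * L.ω₂ - eta₂ L * L.ω₁ = 2 * Real.pi * Complex.I :=
  (legendre_and_oddTheta_eq hIm).1

end QuasiPeriods

section Theta

/-! ### The sigma functions with characteristic -/

section SigmaChar

variable {L : PeriodPair} (hIm : 0 < (L.ω₂ / L.ω₁).im)
include hIm

/-- `θ[1/2,1/2](z)` is a zero-free function times `σ(ω₁ z)`, and `σ` has a simple zero at `0`.
Without this the division by `θ₁₁'` in `σ[p,q]` would be by the default convention. -/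
lemma theta₁₁'_ne_zero : theta₁₁' (L.ω₂ / L.ω₁) ≠ 0 := by
  obtain ⟨-, c, b, hc, h⟩ := legendre_and_oddTheta_eq hIm
  have hω := ω₁_ne_zero L
  set Ω := L.ω₂ / L.ω₁ with hΩ
  set K : ℂ → ℂ := fun z ↦ Complex.exp (Real.pi * Complex.I * (1 / 2) ^ 2 * Ω +
    2 * Real.pi * Complex.I * (1 / 2) * (z + 1 / 2)) *
    (c * Complex.exp (-(eta₁ L / (2 * L.ω₁)) * (L.ω₁ * z) ^ 2 + b * (L.ω₁ * z))) with hK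
  have hKd : Differentiable ℂ K := by
    unfold K
    fun_prop
  have h1 : (fun z ↦ theta (1 / 2) (1 / 2) z Ω) = fun z ↦ K z * sigma L (L.ω₁ * z) := by
    ext z
    have h2 := h (L.ω₁ * z)
    rw [oddTheta, mul_div_cancel_left₀ _ hω, ← hΩ] at h2
    rw [theta_eq, show z + 1 / 2 + 1 / 2 * Ω = z + (1 + Ω) / 2 by ring, h2, hK]
    ring
  have h2 : HasDerivAt (fun z ↦ sigma L (L.ω₁ * z)) L.ω₁ 0 := by
    have h3 : HasDerivAt (sigma L) 1 (L.ω₁ * 0) := by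
      rw [mul_zero, ← deriv_sigma_zero L]
      exact (differentiable_sigma L 0).hasDerivAt
    have := HasDerivAt.scomp (0 : ℂ) h3 ((hasDerivAt_id (0 : ℂ)).const_mul L.ω₁)
    simpa [Function.comp_def] using this
  have h3 := (hKd 0).hasDerivAt.fun_mul h2
  rw [← h1] at h3
  rw [theta₁₁', h3.deriv]
  simp only [mul_zero, sigma_zero, zero_add]
  exact mul_ne_zero (mul_ne_zero (Complex.exp_ne_zero _) (mul_ne_zero hc (Complex.exp_ne_zero _))) hω

/-- The sigma function with characteristic is a translate of the sigma function, up to an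
exponential factor. -/
lemma exists_sigmaChar_eq (p q : ℂ) : ∃ A B c₀ : ℂ, A ≠ 0 ∧
    ∀ u, sigmaChar L p q u = A * Complex.exp (B * u) * sigma L (u + c₀) := by
  obtain ⟨-, c, b, hc, h⟩ := legendre_and_oddTheta_eq hIm
  have hω := ω₁_ne_zero L
  -- With this translation, `u / ω₁ + q + pΩ`, the argument of `jacobiTheta₂` in `θ[p,q]`, is the
  -- argument of `oddTheta` at `u + c₀`.
  set c₀ := (q - 1 / 2) * L.ω₁ + (p - 1 / 2) * L.ω₂ with hc₀
  refine ⟨L.ω₁ / theta₁₁' (L.ω₂ / L.ω₁) * c * Complex.exp (Real.pi * Complex.I * p ^ 2 *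
      (L.ω₂ / L.ω₁) + 2 * Real.pi * Complex.I * p * q - eta₁ L / (2 * L.ω₁) * c₀ ^ 2 + b * c₀),
    2 * Real.pi * Complex.I * p / L.ω₁ - eta₁ L * c₀ / L.ω₁ + b, c₀,
    mul_ne_zero (mul_ne_zero (div_ne_zero hω (theta₁₁'_ne_zero hIm)) hc) (Complex.exp_ne_zero _),
    fun u ↦ ?_⟩
  have h1 := h (u + c₀)
  rw [oddTheta, show (u + c₀) / L.ω₁ + (1 + L.ω₂ / L.ω₁) / 2 =
    u / L.ω₁ + q + p * (L.ω₂ / L.ω₁) by rw [hc₀]; field_simp; ring] at h1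
  rw [sigmaChar, theta_eq, h1]
  have h2 : Complex.exp (eta₁ L / (2 * L.ω₁) * u ^ 2) *
      Complex.exp (Real.pi * Complex.I * p ^ 2 * (L.ω₂ / L.ω₁) +
        2 * Real.pi * Complex.I * p * (u / L.ω₁ + q)) *
      Complex.exp (-(eta₁ L / (2 * L.ω₁)) * (u + c₀) ^ 2 + b * (u + c₀)) =
      Complex.exp (Real.pi * Complex.I * p ^ 2 * (L.ω₂ / L.ω₁) + 2 * Real.pi * Complex.I * p * q -
        eta₁ L / (2 * L.ω₁) * c₀ ^ 2 + b * c₀) *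
      Complex.exp ((2 * Real.pi * Complex.I * p / L.ω₁ - eta₁ L * c₀ / L.ω₁ + b) * u) := by
    rw [← Complex.exp_add, ← Complex.exp_add, ← Complex.exp_add]
    congr 1
    field_simp
    ring
  linear_combination L.ω₁ / theta₁₁' (L.ω₂ / L.ω₁) * c * sigma L (u + c₀) * h2

lemma differentiable_sigmaChar (p q : ℂ) : Differentiable ℂ (sigmaChar L p q) := by
  obtain ⟨A, B, c₀, -, h⟩ := exists_sigmaChar_eq hIm p q
  rw [funext h]
  have := differentiable_sigma L
  fun_prop

omit hIm in
lemma sigmaChar_add_ω₁ (p q u : ℂ) : sigmaChar L p q (u + L.ω₁) =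
    Complex.exp (eta₁ L * (u + L.ω₁ / 2) + 2 * Real.pi * Complex.I * p) *
      sigmaChar L p q u := by
  have hω := ω₁_ne_zero L
  simp only [sigmaChar, theta_eq]
  rw [show (u + L.ω₁) / L.ω₁ + q + p * (L.ω₂ / L.ω₁) = u / L.ω₁ + q + p * (L.ω₂ / L.ω₁) + 1 by
    field_simp; ring, jacobiTheta₂_add_left]
  have h : Complex.exp (eta₁ L / (2 * L.ω₁) * (u + L.ω₁) ^ 2) *
      Complex.exp (Real.pi * Complex.I * p ^ 2 * (L.ω₂ / L.ω₁) +
        2 * Real.pi * Complex.I * p * ((u + L.ω₁) / L.ω₁ + q)) =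
      Complex.exp (eta₁ L * (u + L.ω₁ / 2) + 2 * Real.pi * Complex.I * p) *
      Complex.exp (eta₁ L / (2 * L.ω₁) * u ^ 2) *
      Complex.exp (Real.pi * Complex.I * p ^ 2 * (L.ω₂ / L.ω₁) +
        2 * Real.pi * Complex.I * p * (u / L.ω₁ + q)) := by
    simp only [← Complex.exp_add]
    congr 1
    field_simp
    ring
  linear_combination L.ω₁ / theta₁₁' (L.ω₂ / L.ω₁) *
    jacobiTheta₂ (u / L.ω₁ + q + p * (L.ω₂ / L.ω₁)) (L.ω₂ / L.ω₁) * h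

/-- The Gaussian factor involves only `η₁`; the Legendre relation combines it with the theta
multiplier to produce `η₂`. -/
lemma sigmaChar_add_ω₂ (p q u : ℂ) : sigmaChar L p q (u + L.ω₂) =
    Complex.exp (eta₂ L * (u + L.ω₂ / 2) - 2 * Real.pi * Complex.I * q) *
      sigmaChar L p q u := by
  have hω := ω₁_ne_zero L
  have hleg := legendre hIm
  simp only [sigmaChar, theta_eq]
  rw [show (u + L.ω₂) / L.ω₁ + q + p * (L.ω₂ / L.ω₁) =
    u / L.ω₁ + q + p * (L.ω₂ / L.ω₁) + L.ω₂ / L.ω₁ by ring, jacobiTheta₂_add_left']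
  have h : Complex.exp (eta₁ L / (2 * L.ω₁) * (u + L.ω₂) ^ 2) *
      Complex.exp (Real.pi * Complex.I * p ^ 2 * (L.ω₂ / L.ω₁) +
        2 * Real.pi * Complex.I * p * ((u + L.ω₂) / L.ω₁ + q)) *
      Complex.exp (-Real.pi * Complex.I * (L.ω₂ / L.ω₁ +
        2 * (u / L.ω₁ + q + p * (L.ω₂ / L.ω₁)))) =
      Complex.exp (eta₂ L * (u + L.ω₂ / 2) - 2 * Real.pi * Complex.I * q) *
      Complex.exp (eta₁ L / (2 * L.ω₁) * u ^ 2) *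
      Complex.exp (Real.pi * Complex.I * p ^ 2 * (L.ω₂ / L.ω₁) +
        2 * Real.pi * Complex.I * p * (u / L.ω₁ + q)) := by
    simp only [← Complex.exp_add]
    congr 1
    field_simp
    linear_combination (2 * u + L.ω₂) * hleg
  linear_combination L.ω₁ / theta₁₁' (L.ω₂ / L.ω₁) *
    jacobiTheta₂ (u / L.ω₁ + q + p * (L.ω₂ / L.ω₁)) (L.ω₂ / L.ω₁) * h

end SigmaChar

/-! ### Relations between values of the sigma function -/

variable (L : PeriodPair)

lemma continuous_sigma : Continuous (sigma L) := (differentiable_sigma L).continuous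

/-- The products of `n` translates of sigma have the same multipliers. -/
lemma exists_sigma_translates_add {ω : ℂ} (hω : ω ∈ L.lattice) : ∃ η κ : ℂ,
    κ ^ 2 = Complex.exp (η * ω) ∧
    ∀ z v, sigma L (z + ω + v) = κ * Complex.exp (η * z) * Complex.exp (η * v) * sigma L (z + v) := by
  obtain ⟨η, κ, h1, h2⟩ := exists_sigma_add L hω
  refine ⟨η, κ, h1, fun z v ↦ ?_⟩
  rw [add_right_comm, h2, mul_add, Complex.exp_add]
  ring

/-- The entire function `σ² ℘`. -/
noncomputable def sigmaSqP (z : ℂ) : ℂ :=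
  deriv (sigma L) z ^ 2 - sigma L z * deriv (deriv (sigma L)) z

lemma sigmaSqP_eq {z : ℂ} (hz : z ∉ L.lattice) :
    sigmaSqP L z = sigma L z ^ 2 * L.weierstrassP z := by
  have h1 : deriv (sigma L) =ᶠ[𝓝 z] fun z ↦ zeta L z * sigma L z := by
    filter_upwards [(isOpen_compl_lattice L).mem_nhds hz] with w hw
    exact deriv_sigma L hw
  have h2 := (hasDerivAt_zeta L hz).mul (hasDerivAt_sigma L hz)
  have h3 : deriv (deriv (sigma L)) z = _ := h1.deriv_eq.trans h2.deriv
  rw [sigmaSqP, h3, deriv_sigma L hz]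
  ring

lemma differentiable_sigmaSqP : Differentiable ℂ (sigmaSqP L) := by
  have h0 := differentiable_sigma L
  have h1 : Differentiable ℂ (deriv (sigma L)) := fun z ↦ (h0.analyticAt z).deriv.differentiableAt
  have h2 : Differentiable ℂ (deriv (deriv (sigma L))) :=
    fun z ↦ (h1.analyticAt z).deriv.differentiableAt
  unfold sigmaSqP
  fun_prop

lemma sigmaSqP_zero : sigmaSqP L 0 = 1 := by
  simp [sigmaSqP, deriv_sigma_zero]

lemma two_mul_mem_of_sub_add_mem {L : PeriodPair} {z w : ℂ} (h1 : z - w ∈ L.lattice) (h2 : z + w ∈ L.lattice) :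
    2 * w ∈ L.lattice := by
  have := L.lattice.sub_mem h2 h1
  rwa [show z + w - (z - w) = 2 * w by ring] at this

/-- `σ(z + w) σ(z - w) = -σ(z)² σ(w)² (℘(z) - ℘(w))`, where `σ(z)² ℘(z)` is extended to the
points of the lattice. -/
lemma sigma_add_mul_sigma_sub_of_two_mul_notMem {w : ℂ} (hw : 2 * w ∉ L.lattice) (z : ℂ) :
    sigma L (z + w) * sigma L (z - w) =
      -sigma L w ^ 2 * (sigmaSqP L z - L.weierstrassP w * sigma L z ^ 2) := by
  have hw' : w ∉ L.lattice := fun h ↦ hw (by rw [two_mul]; exact L.lattice.add_mem h h)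
  have hd := differentiable_sigma L
  set f : ℂ → ℂ := fun z ↦ sigmaSqP L z - L.weierstrassP w * sigma L z ^ 2 with hf
  set g : ℂ → ℂ := fun z ↦ sigma L (z + w) * sigma L (z - w) with hg
  have hfd : Differentiable ℂ f := by
    have := differentiable_sigmaSqP L
    unfold f
    fun_prop
  have hgd : Differentiable ℂ g := by
    unfold g
    fun_prop
  have hfz : ∀ z ∉ L.lattice, f z = sigma L z ^ 2 * (L.weierstrassP z - L.weierstrassP w) := by
    intro z hz
    simp only [f]
    rw [sigmaSqP_eq L hz]
    ring
  have hg0 : ∀ z, g z = 0 ↔ z + w ∈ L.lattice ∨ z - w ∈ L.lattice := by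
    intro z
    simp only [g, mul_eq_zero, sigma_eq_zero_iff]
  have h0 : ∀ z, g z = 0 → f z = 0 := by
    intro z hz
    rw [hg0] at hz
    have hz' : z ∉ L.lattice := by
      intro h
      rcases hz with hz | hz
      · exact hw' ((L.lattice.add_mem_iff_right h).1 hz)
      · exact hw' ((L.lattice.sub_mem_iff_right h).1 hz)
    rw [hfz z hz']
    rcases hz with hz | hz
    · rw [← L.weierstrassP_neg w, show z = -w + (z + w) by ring,
        L.weierstrassP_add_coe (-w) ⟨_, hz⟩]
      ring
    · nth_rewrite 2 [show z = w + (z - w) by ring]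
      rw [L.weierstrassP_add_coe w ⟨_, hz⟩]
      ring
  -- As `2w ∉ Λ`, the two factors of `g` have no common zero, so the zeros are simple.
  have hs : ∀ z, g z = 0 → deriv g z ≠ 0 := by
    intro z hz
    have h1 := ((hd (z + w)).hasDerivAt.comp_add_const z w).fun_mul
      ((hd (z - w)).hasDerivAt.comp_sub_const z w)
    rw [show deriv g z = _ from h1.deriv]
    rcases (hg0 z).1 hz with hz | hz
    · have : z - w ∉ L.lattice := fun h ↦ hw (two_mul_mem_of_sub_add_mem h hz)
      rw [(sigma_eq_zero_iff L).2 hz, zero_mul, add_zero]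
      exact mul_ne_zero (deriv_sigma_ne_zero L hz) (sigma_ne_zero L this)
    · have : z + w ∉ L.lattice := fun h ↦ hw (two_mul_mem_of_sub_add_mem hz h)
      rw [(sigma_eq_zero_iff L).2 hz, mul_zero, zero_add]
      exact mul_ne_zero (sigma_ne_zero L this) (deriv_sigma_ne_zero L hz)
  obtain ⟨h, hh, hq⟩ := exists_entire_quotient hfd hgd hs h0
  -- Numerator and denominator have the same multipliers. The comparison is made where nothing
  -- vanishes and extends by density; the constant is found at `z = 0`, where `σ²℘` has the value
  -- `1`.
  have hper : ∀ z, ∀ ω ∈ L.lattice, h (z + ω) = h z := by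
    intro z ω hω
    have hdense : Dense {z | z ∉ L.lattice ∧ z + w ∉ L.lattice ∧ z - w ∉ L.lattice} := by
      have hc : ((L.lattice : Set ℂ) ∪ ((· + w) ⁻¹' (L.lattice : Set ℂ) ∪
          (· - w) ⁻¹' (L.lattice : Set ℂ))).Countable :=
        (countable_lattice L).union (((countable_lattice L).preimage (add_left_injective w)).union
          ((countable_lattice L).preimage (sub_left_injective)))
      refine (hc.dense_compl ℝ).mono ?_
      intro z hz
      simpa using hz
    have hcont := hh.continuous
    refine congrFun (Continuous.ext_on (f := fun z ↦ h (z + ω)) (g := h) hdense (by fun_prop)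
      hcont ?_) z
    rintro z ⟨hz1, hz2, hz3⟩
    have hz4 : z + ω ∉ L.lattice := fun hz ↦ hz1 ((add_mem_lattice_iff hω).1 hz)
    obtain ⟨η, κ, -, hk⟩ := exists_sigma_translates_add L hω
    have e1 := hq (z + ω)
    rw [hfz _ hz4, L.weierstrassP_add_coe z ⟨ω, hω⟩] at e1
    have e2 := hq z
    rw [hfz _ hz1] at e2
    have e3 : sigma L (z + ω) = κ * Complex.exp (η * z) * sigma L z := by
      simpa using hk z 0
    have e4 : g (z + ω) = (κ * Complex.exp (η * z)) ^ 2 * g z := by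
      simp only [g]
      rw [hk z w, sub_eq_add_neg, hk z (-w), ← sub_eq_add_neg]
      have : Complex.exp (η * w) * Complex.exp (η * -w) = 1 := by
        rw [← Complex.exp_add]
        simp
      linear_combination κ ^ 2 * Complex.exp (η * z) ^ 2 * sigma L (z + w) * sigma L (z - w) * this
    rw [e3, e4] at e1
    have hne : κ * Complex.exp (η * z) ≠ 0 := by
      intro h
      rw [h, zero_mul] at e3
      exact sigma_ne_zero L hz4 e3
    have hgne : g z ≠ 0 := by
      rw [Ne, hg0]
      tauto
    have : (κ * Complex.exp (η * z)) ^ 2 * g z ≠ 0 := mul_ne_zero (pow_ne_zero 2 hne) hgne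
    refine mul_right_cancel₀ this ?_
    rw [← e1]
    linear_combination (κ * Complex.exp (η * z)) ^ 2 * e2
  have hconst := eq_const_of_periodic L hh hper z 0
  have e1 := hq 0
  have e2 := hq z
  rw [hconst] at e2
  simp only [f, g, sigmaSqP_zero, sigma_zero, zero_add, zero_sub, sigma_neg] at e1 e2
  rw [e2]
  linear_combination sigma L (z + w) * sigma L (z - w) * e1

lemma dense_two_mul_notMem : Dense {w : ℂ | 2 * w ∉ L.lattice} :=
  ((countable_lattice L).preimage (mul_right_injective₀ (two_ne_zero' ℂ))).dense_compl ℝ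

/-- The half-periods `w` are reached by continuity in `w`. -/
lemma sigma_add_mul_sigma_sub {w : ℂ} (hw : w ∉ L.lattice) (z : ℂ) :
    sigma L (z + w) * sigma L (z - w) =
      -sigma L w ^ 2 * (sigmaSqP L z - L.weierstrassP w * sigma L z ^ 2) := by
  have hcP : ContinuousAt L.weierstrassP w :=
    (L.differentiableOn_weierstrassP.differentiableAt
      ((isOpen_compl_lattice L).mem_nhds hw)).continuousAt
  have hcs := continuous_sigma L
  have h1 : Tendsto (fun w ↦ sigma L (z + w) * sigma L (z - w)) (𝓝[{w | 2 * w ∉ L.lattice}] w)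
      (𝓝 (sigma L (z + w) * sigma L (z - w))) :=
    (Continuous.tendsto (by fun_prop) w).mono_left nhdsWithin_le_nhds
  have h2 : Tendsto
      (fun w ↦ -sigma L w ^ 2 * (sigmaSqP L z - L.weierstrassP w * sigma L z ^ 2))
      (𝓝[{w | 2 * w ∉ L.lattice}] w)
      (𝓝 (-sigma L w ^ 2 * (sigmaSqP L z - L.weierstrassP w * sigma L z ^ 2))) :=
    Tendsto.mono_left (ContinuousAt.tendsto (f := fun w ↦ -sigma L w ^ 2 *
      (sigmaSqP L z - L.weierstrassP w * sigma L z ^ 2)) (by fun_prop)) nhdsWithin_le_nhds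
  have : (𝓝[{w | 2 * w ∉ L.lattice}] w).NeBot :=
    mem_closure_iff_nhdsWithin_neBot.1 (dense_two_mul_notMem L w)
  refine tendsto_nhds_unique (h1.congr' ?_) h2
  filter_upwards [self_mem_nhdsWithin] with v hv
  exact sigma_add_mul_sigma_sub_of_two_mul_notMem L hv z

lemma weierstrassP_sub_weierstrassP {z w : ℂ} (hz : z ∉ L.lattice) (hw : w ∉ L.lattice) :
    sigma L (z + w) * sigma L (z - w) =
      -sigma L z ^ 2 * sigma L w ^ 2 * (L.weierstrassP z - L.weierstrassP w) := by
  rw [sigma_add_mul_sigma_sub L hw, sigmaSqP_eq L hz]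
  ring

lemma weierstrassP_eq_iff {z w : ℂ} (hz : z ∉ L.lattice) (hw : w ∉ L.lattice) :
    L.weierstrassP z = L.weierstrassP w ↔ z + w ∈ L.lattice ∨ z - w ∈ L.lattice := by
  have h := weierstrassP_sub_weierstrassP L hz hw
  rw [← sigma_eq_zero_iff, ← sigma_eq_zero_iff, ← mul_eq_zero, h, mul_eq_zero, sub_eq_zero,
    or_iff_right]
  exact mul_ne_zero (neg_ne_zero.2 (pow_ne_zero 2 (sigma_ne_zero L hz)))
    (pow_ne_zero 2 (sigma_ne_zero L hw))

lemma hasDerivAt_weierstrassP {z : ℂ} (hz : z ∉ L.lattice) :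
    HasDerivAt L.weierstrassP (L.derivWeierstrassP z) z := by
  rw [← L.deriv_weierstrassP]
  exact (L.differentiableOn_weierstrassP.differentiableAt
      ((isOpen_compl_lattice L).mem_nhds hz)).hasDerivAt

/-- This is the derivative in `z`, at `z = w`, of the formula for `σ(z + w) σ(z - w)`. It locates
the zeros of `℘'` at the half-periods. -/
lemma sigma_two_mul {w : ℂ} (hw : w ∉ L.lattice) :
    sigma L (2 * w) = -sigma L w ^ 4 * L.derivWeierstrassP w := by
  have hs := differentiable_sigma L
  have h1 : HasDerivAt (fun z ↦ sigma L (z + w) * sigma L (z - w)) (sigma L (2 * w)) w := by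
    have := ((hs (w + w)).hasDerivAt.comp_add_const w w).fun_mul
      ((hs (w - w)).hasDerivAt.comp_sub_const w w)
    simpa [deriv_sigma_zero, two_mul] using this
  have h2 : HasDerivAt (fun z ↦ -sigma L z ^ 2 * sigma L w ^ 2 *
      (L.weierstrassP z - L.weierstrassP w)) (-sigma L w ^ 4 * L.derivWeierstrassP w) w := by
    have := ((((hs w).hasDerivAt.fun_pow 2).fun_neg).mul_const (sigma L w ^ 2)).fun_mul
      ((hasDerivAt_weierstrassP L hw).sub_const (L.weierstrassP w))
    convert! this using 1
    ring
  refine h1.unique (h2.congr_of_eventuallyEq ?_)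
  filter_upwards [(isOpen_compl_lattice L).mem_nhds hw] with z hz
  exact weierstrassP_sub_weierstrassP L hz hw

lemma derivWeierstrassP_eq_zero_iff {w : ℂ} (hw : w ∉ L.lattice) :
    L.derivWeierstrassP w = 0 ↔ 2 * w ∈ L.lattice := by
  rw [← sigma_eq_zero_iff, sigma_two_mul L hw, mul_eq_zero, or_iff_right]
  exact neg_ne_zero.2 (pow_ne_zero 4 (sigma_ne_zero L hw))

/-- If `℘` omitted `x`, then `1 / (℘ - x)`, written as a quotient of entire functions, would be
entire and elliptic, hence constant. But it vanishes on the lattice and not at `ω₁ / 2`. -/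
lemma exists_weierstrassP_eq (x : ℂ) : ∃ z, z ∉ L.lattice ∧ L.weierstrassP z = x := by
  by_contra! h
  set f : ℂ → ℂ := fun z ↦ sigmaSqP L z - x * sigma L z ^ 2 with hf
  have hfd : Differentiable ℂ f := by
    have := differentiable_sigmaSqP L
    have := differentiable_sigma L
    unfold f
    fun_prop
  have hfz : ∀ z ∉ L.lattice, f z = sigma L z ^ 2 * (L.weierstrassP z - x) := by
    intro z hz
    simp only [f]
    rw [sigmaSqP_eq L hz]
    ring
  have hne : ∀ z, f z ≠ 0 := by
    intro z
    by_cases hz : z ∈ L.lattice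
    · simp only [f, sigmaSqP, (sigma_eq_zero_iff L).2 hz]
      simpa using deriv_sigma_ne_zero L hz
    · rw [hfz z hz]
      exact mul_ne_zero (pow_ne_zero 2 (sigma_ne_zero L hz)) (sub_ne_zero.2 (h z hz))
  have hgd : Differentiable ℂ fun z ↦ sigma L z ^ 2 / f z := by
    have := differentiable_sigma L
    exact fun z ↦ DifferentiableAt.fun_div (by fun_prop) (hfd z) (hne z)
  have hgz : ∀ z ∉ L.lattice, sigma L z ^ 2 / f z = 1 / (L.weierstrassP z - x) := by
    intro z hz
    have := sigma_ne_zero L hz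
    have := sub_ne_zero.2 (h z hz)
    rw [hfz z hz]
    field_simp
  have hconst := eq_const_of_periodic L hgd (fun z ω hω ↦ by
    by_cases hz : z ∈ L.lattice
    · rw [(sigma_eq_zero_iff L).2 hz, (sigma_eq_zero_iff L).2 (L.lattice.add_mem hz hω)]
      simp
    · have hz4 : z + ω ∉ L.lattice := fun h ↦ hz ((add_mem_lattice_iff hω).1 h)
      rw [hgz z hz, hgz _ hz4, L.weierstrassP_add_coe z ⟨ω, hω⟩]) (L.ω₁ / 2) 0
  have h2 := L.ω₁_div_two_notMem_lattice
  simp only [sigma_zero] at hconst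
  rw [zero_pow two_ne_zero, zero_div, div_eq_zero_iff, or_iff_left (hne _)] at hconst
  exact pow_ne_zero 2 (sigma_ne_zero L h2) hconst

/-! ### The four-term relation -/

/-- The left-hand side of the four-term relation. -/
noncomputable def fourTerm (f g T u : ℂ) : ℂ :=
  sigma L (u + (f + T)) * sigma L (u + -f) * sigma L (u + (-g + -T)) * sigma L (u + g) -
    sigma L (u + (-f + -T)) * sigma L (u + f) * sigma L (u + (g + T)) * sigma L (u + -g)

lemma fourTerm_neg (f g T u : ℂ) : fourTerm L f g T (-u) = -fourTerm L f g T u := by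
  simp only [fourTerm]
  rw [show -u + (f + T) = -(u + (-f + -T)) by ring, show -u + -f = -(u + f) by ring,
    show -u + (-g + -T) = -(u + (g + T)) by ring, show -u + g = -(u + -g) by ring,
    show -u + (-f + -T) = -(u + (f + T)) by ring, show -u + f = -(u + -f) by ring,
    show -u + (g + T) = -(u + (-g + -T)) by ring, show -u + -g = -(u + g) by ring]
  simp only [sigma_neg]
  ring

/-- In each product the four shifts add up to zero, so the multiplier does not depend on `f`, `g`,
`T`; it is that of `σ(2u)`. -/
lemma exists_fourTerm_add {ω : ℂ} (hω : ω ∈ L.lattice) : ∃ η : ℂ,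
    (∀ f g T u, fourTerm L f g T (u + ω) =
      Complex.exp (η * (4 * u + 2 * ω)) * fourTerm L f g T u) ∧
    ∀ u, sigma L (2 * (u + ω)) = Complex.exp (η * (4 * u + 2 * ω)) * sigma L (2 * u) := by
  obtain ⟨η, κ, hκ, h⟩ := exists_sigma_translates_add L hω
  have hexp : ∀ u, Complex.exp (η * (4 * u + 2 * ω)) = κ ^ 4 * Complex.exp (η * u) ^ 4 := by
    intro u
    rw [show κ ^ 4 = (κ ^ 2) ^ 2 by ring, hκ, ← Complex.exp_nat_mul, ← Complex.exp_nat_mul,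
      ← Complex.exp_add]
    congr 1
    push_cast
    ring
  refine ⟨η, fun f g T u ↦ ?_, fun u ↦ ?_⟩
  · have h1 : ∀ v, Complex.exp (η * v) * Complex.exp (η * -v) = 1 := fun v ↦ by
      rw [← Complex.exp_add]
      simp
    have hmul : ∀ v w, Complex.exp (η * (v + w)) = Complex.exp (η * v) * Complex.exp (η * w) :=
      fun v w ↦ by rw [mul_add, Complex.exp_add]
    have key : ∀ v w x : ℂ, ∀ a b c d : ℂ,
        κ * Complex.exp (η * u) * Complex.exp (η * (v + w)) * a *
        (κ * Complex.exp (η * u) * Complex.exp (η * -v) * b) *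
        (κ * Complex.exp (η * u) * Complex.exp (η * (-x + -w)) * c) *
        (κ * Complex.exp (η * u) * Complex.exp (η * x) * d) =
        κ ^ 4 * Complex.exp (η * u) ^ 4 * (a * b * c * d) := by
      intro v w x a b c d
      have : Complex.exp (η * (v + w)) * Complex.exp (η * -v) * Complex.exp (η * (-x + -w)) *
          Complex.exp (η * x) = 1 := by
        simp only [← Complex.exp_add]
        rw [Complex.exp_eq_one_iff]
        exact ⟨0, by push_cast; ring⟩
      linear_combination κ ^ 4 * Complex.exp (η * u) ^ 4 * a * b * c * d * this
    simp only [fourTerm, h]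
    rw [key f T g]
    have key2 := key (-f) (-T) (-g) (sigma L (u + (-f + -T))) (sigma L (u + f))
      (sigma L (u + (g + T))) (sigma L (u + -g))
    rw [neg_neg, neg_neg, neg_neg] at key2
    rw [key2, hexp]
    ring
  · rw [show 2 * (u + ω) = 2 * u + ω + ω by ring, h (2 * u) ω]
    have h2 := h (2 * u) 0
    simp only [add_zero, mul_zero, Complex.exp_zero, mul_one] at h2
    rw [h2, hexp, ← hκ, show η * (2 * u) = η * u + η * u by ring, Complex.exp_add]
    ring

/-- Translation by `2u` takes `-u` to `u` with multiplier `1`, so oddness makes the value equal to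
its negative. -/
lemma fourTerm_eq_zero {u : ℂ} (hu : 2 * u ∈ L.lattice) (f g T : ℂ) : fourTerm L f g T u = 0 := by
  obtain ⟨η, h, -⟩ := exists_fourTerm_add L hu
  have h1 := h f g T (-u)
  rw [show -u + 2 * u = u by ring, fourTerm_neg,
    show η * (4 * -u + 2 * (2 * u)) = 0 by ring, Complex.exp_zero] at h1
  have : 2 * fourTerm L f g T u = 0 := by linear_combination h1
  simpa using this

lemma differentiable_fourTerm (f g T : ℂ) : Differentiable ℂ (fourTerm L f g T) := by
  have := differentiable_sigma L
  unfold fourTerm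
  fun_prop

lemma hasDerivAt_sigma_two_mul (u : ℂ) :
    HasDerivAt (fun u ↦ sigma L (2 * u)) (2 * deriv (sigma L) (2 * u)) u := by
  have := (differentiable_sigma L (2 * u)).hasDerivAt.comp u ((hasDerivAt_id u).const_mul 2)
  simpa [Function.comp_def, mul_comm] using this

lemma exists_fourTerm_eq_const_mul (f g T : ℂ) :
    ∃ C, ∀ u, fourTerm L f g T u = C * sigma L (2 * u) := by
  obtain ⟨h, hh, hq⟩ := exists_entire_quotient (differentiable_fourTerm L f g T)
    (g := fun u ↦ sigma L (2 * u)) (fun u ↦ (hasDerivAt_sigma_two_mul L u).differentiableAt)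
    (fun u hu ↦ by
      rw [(hasDerivAt_sigma_two_mul L u).deriv]
      exact mul_ne_zero two_ne_zero (deriv_sigma_ne_zero L ((sigma_eq_zero_iff L).1 hu)))
    (fun u hu ↦ fourTerm_eq_zero L ((sigma_eq_zero_iff L).1 hu) f g T)
  refine ⟨h 0, fun u ↦ ?_⟩
  rw [hq u, eq_const_of_periodic L hh ?_ u 0]
  intro z ω hω
  have hcont := hh.continuous
  refine congrFun (Continuous.ext_on (f := fun z ↦ h (z + ω)) (g := h) (dense_two_mul_notMem L)
    (by fun_prop) hcont ?_) z
  intro z hz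
  obtain ⟨η, h1, h2⟩ := exists_fourTerm_add L hω
  have e1 := hq (z + ω)
  rw [h1, h2, hq z] at e1
  refine (mul_right_cancel₀ (mul_ne_zero (Complex.exp_ne_zero (η * (4 * z + 2 * ω)))
    (sigma_ne_zero L hz)) ?_).symm
  linear_combination e1

/-- The four-term relation. -/
lemma fourTerm_eq (f g T u : ℂ) :
    fourTerm L f g T u =
      sigma L T * sigma L (f + g + T) * sigma L (f - g) * sigma L (2 * u) := by
  have hs := continuous_sigma L
  -- By continuity in `f` one may assume `2f ∉ Λ`. The constant is then found at `u = f`, where the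
  -- first product contains `σ(0)`.
  refine congrFun (Continuous.ext_on (f := fun f ↦ fourTerm L f g T u)
    (g := fun f ↦ sigma L T * sigma L (f + g + T) * sigma L (f - g) * sigma L (2 * u))
    (dense_two_mul_notMem L) (by unfold fourTerm; fun_prop) (by fun_prop) ?_) f
  intro f hf
  obtain ⟨C, hC⟩ := exists_fourTerm_eq_const_mul L f g T
  have h1 := hC f
  have h2 : fourTerm L f g T f =
      sigma L T * sigma L (f + g + T) * sigma L (f - g) * sigma L (2 * f) := by
    simp only [fourTerm]
    rw [add_neg_cancel, sigma_zero, show f + (-f + -T) = -T by ring, sigma_neg,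
      show f + (g + T) = f + g + T by ring, ← two_mul, ← sub_eq_add_neg]
    ring_nf
  rw [h1] at h2
  simp only
  rw [hC u, mul_right_cancel₀ (sigma_ne_zero L hf) h2]

end Theta

section MatrixPhi

/-! ### The matrix `Φ` -/

section Multipliers

variable {L : PeriodPair} {p q ω η c : ℂ}
  (hσ : ∀ z, sigma L (z + ω) = -Complex.exp (η * (z + ω / 2)) * sigma L z)
  (hS : ∀ z, sigmaChar L p q (z + ω) = Complex.exp (η * (z + ω / 2) + c) * sigmaChar L p q z)
  (hζ : ∀ z, z ∉ L.lattice → zeta L (z + ω) = zeta L z + η)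
include hσ hS hζ

/-- The contributions of `v` cancel between the two sigma functions. That of `t` is cancelled by the
two zeta functions, each of which changes by `η`. The multiplier is thus independent of `v`, that
is, of the row. -/
lemma entry_add {t α v u : ℂ} (h1 : u - α ∉ L.lattice) (h2 : u + α ∉ L.lattice) :
    entry L p q t α v (u + ω) =
      -(Complex.exp c * Complex.exp (η * (2 * u + ω))) * entry L p q t α v u := by
  simp only [entry]
  rw [show u + ω + v + t = u + v + t + ω by ring, hS, show u + ω - v = u - v + ω by ring, hσ,
    show u + ω - α = u - α + ω by ring, hζ _ h1, show u + ω + α = u + α + ω by ring, hζ _ h2]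
  have h : Complex.exp (η * (u + v + t + ω / 2) + c) * Complex.exp (η * (u - v + ω / 2)) *
      Complex.exp (-(t / 2) * (zeta L (u - α) + η + (zeta L (u + α) + η))) =
      Complex.exp c * Complex.exp (η * (2 * u + ω)) *
        Complex.exp (-(t / 2) * (zeta L (u - α) + zeta L (u + α))) := by
    simp only [← Complex.exp_add]
    congr 1
    ring
  linear_combination -sigmaChar L p q (u + v + t) * sigma L (u - v) * h

/-- The second column moves by `-ω`: the relation for the first column is used at `-(u + ω)` and
inverted, which replaces `c` by `-c` but keeps the common factor. -/
lemma entry_neg_add {t α v u : ℂ} (hω : ω ∈ L.lattice) (h1 : u - α ∉ L.lattice)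
    (h2 : u + α ∉ L.lattice) :
    entry L p q t α v (-(u + ω)) =
      -(Complex.exp (-c) * Complex.exp (η * (2 * u + ω))) * entry L p q t α v (-u) := by
  have h3 : -(u + ω) - α ∉ L.lattice := by
    rw [show -(u + ω) - α = -(u + α + ω) by ring, neg_mem_iff, add_mem_lattice_iff hω]
    exact h2
  have h4 : -(u + ω) + α ∉ L.lattice := by
    rw [show -(u + ω) + α = -(u - α + ω) by ring, neg_mem_iff, add_mem_lattice_iff hω]
    exact h1
  have h5 := entry_add hσ hS hζ (t := t) (v := v) h3 h4
  rw [show -(u + ω) + ω = -u by ring] at h5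
  rw [h5]
  have h : Complex.exp (-c) * Complex.exp (η * (2 * u + ω)) *
      (Complex.exp c * Complex.exp (η * (2 * -(u + ω) + ω))) = 1 := by
    simp only [← Complex.exp_add]
    rw [Complex.exp_eq_one_iff]
    exact ⟨0, by push_cast; ring⟩
  linear_combination -entry L p q t α v (-(u + ω)) * h

lemma Phi_add {t α uφ uψ u a b : ℂ} (hω : ω ∈ L.lattice) (h1 : u - α ∉ L.lattice)
    (h2 : u + α ∉ L.lattice) (ha : a = -Complex.exp c) (hb : b = -Complex.exp (-c)) :
    Phi L p q t α uφ uψ (u + ω) =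
      Complex.exp (η * (2 * u + ω)) • (Phi L p q t α uφ uψ u * !![a, 0; 0, b]) := by
  subst ha hb
  ext i j
  fin_cases i <;> fin_cases j <;>
    simp [Phi, entry_add hσ hS hζ h1 h2,
      entry_neg_add hσ hS hζ hω h1 h2, -neg_add_rev] <;> ring

end Multipliers

section Phi

variable {L : PeriodPair}

lemma Phi_add_ω₁ {p q t α uφ uψ u : ℂ} (h1 : u - α ∉ L.lattice) (h2 : u + α ∉ L.lattice) :
    Phi L p q t α uφ uψ (u + L.ω₁) = Complex.exp (eta₁ L * (2 * u + L.ω₁)) •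
      (Phi L p q t α uφ uψ u * !![Complex.exp (Real.pi * Complex.I * (2 * p + 1)), 0;
        0, Complex.exp (-(Real.pi * Complex.I * (2 * p + 1)))]) := by
  refine Phi_add (c := 2 * Real.pi * Complex.I * p) (sigma_add_ω₁ L) (sigmaChar_add_ω₁ p q)
    (fun _ ↦ zeta_add_ω₁ L) L.ω₁_mem_lattice h1 h2 ?_ ?_
  · rw [show Real.pi * Complex.I * (2 * p + 1) = 2 * Real.pi * Complex.I * p +
      Real.pi * Complex.I by ring, Complex.exp_add, Complex.exp_pi_mul_I]
    ring
  · rw [show -(Real.pi * Complex.I * (2 * p + 1)) = -(2 * Real.pi * Complex.I * p) -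
      Real.pi * Complex.I by ring, Complex.exp_sub, Complex.exp_pi_mul_I]
    ring

variable (hIm : 0 < (L.ω₂ / L.ω₁).im)
include hIm

lemma Phi_add_ω₂ {p q t α uφ uψ u : ℂ} (h1 : u - α ∉ L.lattice) (h2 : u + α ∉ L.lattice) :
    Phi L p q t α uφ uψ (u + L.ω₂) = Complex.exp (eta₂ L * (2 * u + L.ω₂)) •
      (Phi L p q t α uφ uψ u * !![Complex.exp (-(Real.pi * Complex.I * (2 * q + 1))), 0;
        0, Complex.exp (Real.pi * Complex.I * (2 * q + 1))]) := by
  refine Phi_add (c := -(2 * Real.pi * Complex.I * q)) (sigma_add_ω₂ L)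
    (fun z ↦ by rw [sigmaChar_add_ω₂ hIm, sub_eq_add_neg])
    (fun _ ↦ zeta_add_ω₂ L) L.ω₂_mem_lattice h1 h2 ?_ ?_
  · rw [show -(Real.pi * Complex.I * (2 * q + 1)) = -(2 * Real.pi * Complex.I * q) -
      Real.pi * Complex.I by ring, Complex.exp_sub, Complex.exp_pi_mul_I]
    ring
  · rw [neg_neg, show Real.pi * Complex.I * (2 * q + 1) = 2 * Real.pi * Complex.I * q +
      Real.pi * Complex.I by ring, Complex.exp_add, Complex.exp_pi_mul_I]
    ring

/-- The zeta exponentials of the two columns are inverse to each other, as `ζ` is odd. With `σ[p,q]`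
written as a translate of `σ` by `c₀`, the rest is the four-term relation with `T = t + c₀`. The
formula holds at every `u`, also at the poles of the entries, by the default values. -/
lemma det_Phi (p q t α uφ uψ u : ℂ) : (Phi L p q t α uφ uψ u).det =
    sigmaChar L p q t * sigmaChar L p q (uφ + uψ + t) * sigma L (uφ - uψ) * sigma L (2 * u) := by
  obtain ⟨A, B, c₀, -, h⟩ := exists_sigmaChar_eq hIm p q
  have h4 := fourTerm_eq L uφ uψ (t + c₀) u
  rw [Phi, Matrix.det_fin_two_of]
  simp only [entry, h]
  have hz : zeta L (-u - α) + zeta L (-u + α) = -(zeta L (u - α) + zeta L (u + α)) := by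
    rw [show -u - α = -(u + α) by ring, show -u + α = -(u - α) by ring, zeta_neg, zeta_neg]
    ring
  rw [hz]
  simp only [fourTerm] at h4
  rw [show u + (-uψ + -(t + c₀)) = -(-u + uψ + t + c₀) by ring, sigma_neg,
    show u + (-uφ + -(t + c₀)) = -(-u + uφ + t + c₀) by ring, sigma_neg,
    show u + uψ = -(-u - uψ) by ring, sigma_neg, show u + uφ = -(-u - uφ) by ring, sigma_neg,
    show u + (uφ + (t + c₀)) = u + uφ + t + c₀ by ring,
    show u + (uψ + (t + c₀)) = u + uψ + t + c₀ by ring, ← sub_eq_add_neg, ← sub_eq_add_neg] at h4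
  rw [show uφ + uψ + t + c₀ = uφ + uψ + (t + c₀) by ring]
  have e1 : Complex.exp (-(t / 2) * (zeta L (u - α) + zeta L (u + α))) *
      Complex.exp (-(t / 2) * -(zeta L (u - α) + zeta L (u + α))) = 1 := by
    rw [← Complex.exp_add, Complex.exp_eq_one_iff]
    exact ⟨0, by push_cast; ring⟩
  have e2 : Complex.exp (B * (u + uφ + t)) * Complex.exp (B * (-u + uψ + t)) =
      Complex.exp (B * t) * Complex.exp (B * (uφ + uψ + t)) := by
    simp only [← Complex.exp_add]
    congr 1
    ring
  have e3 : Complex.exp (B * (-u + uφ + t)) * Complex.exp (B * (u + uψ + t)) =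
      Complex.exp (B * t) * Complex.exp (B * (uφ + uψ + t)) := by
    simp only [← Complex.exp_add]
    congr 1
    ring
  generalize Complex.exp (-(t / 2) * (zeta L (u - α) + zeta L (u + α))) = E at *
  generalize Complex.exp (-(t / 2) * -(zeta L (u - α) + zeta L (u + α))) = E' at *
  generalize Complex.exp (B * (u + uφ + t)) = F1 at *
  generalize Complex.exp (B * (-u + uψ + t)) = F2 at *
  generalize Complex.exp (B * (-u + uφ + t)) = F3 at *
  generalize Complex.exp (B * (u + uψ + t)) = F4 at *
  generalize Complex.exp (B * t) = G1 at *
  generalize Complex.exp (B * (uφ + uψ + t)) = G2 at *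
  generalize sigma L (u + uφ + t + c₀) = s1 at *
  generalize sigma L (u - uφ) = s2 at *
  generalize sigma L (-u + uψ + t + c₀) = s3 at *
  generalize sigma L (-u - uψ) = s4 at *
  generalize sigma L (-u + uφ + t + c₀) = s5 at *
  generalize sigma L (-u - uφ) = s6 at *
  generalize sigma L (u + uψ + t + c₀) = s7 at *
  generalize sigma L (u - uψ) = s8 at *
  linear_combination A ^ 2 * G1 * G2 * h4 +
    (A ^ 2 * F1 * F2 * s1 * s2 * s3 * s4 - A ^ 2 * F3 * F4 * s5 * s6 * s7 * s8) * e1 +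
    A ^ 2 * s1 * s2 * s3 * s4 * e2 - A ^ 2 * s5 * s6 * s7 * s8 * e3

lemma analyticAt_entry {p q t α v u : ℂ} (h1 : u - α ∉ L.lattice) (h2 : u + α ∉ L.lattice) :
    AnalyticAt ℂ (entry L p q t α v) u := by
  have hS : AnalyticAt ℂ (sigmaChar L p q) (u + v + t) :=
    (differentiable_sigmaChar hIm p q).analyticAt _
  have hs : AnalyticAt ℂ (sigma L) (u - v) := (differentiable_sigma L).analyticAt _
  have hz1 := analyticAt_zeta L h1
  have hz2 := analyticAt_zeta L h2
  have e1 : AnalyticAt ℂ (fun u ↦ sigmaChar L p q (u + v + t)) u :=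
    hS.fun_comp (f := fun u ↦ u + v + t) (by fun_prop)
  have e2 : AnalyticAt ℂ (fun u ↦ sigma L (u - v)) u :=
    hs.fun_comp (f := fun u ↦ u - v) (by fun_prop)
  have e3 : AnalyticAt ℂ (fun u ↦ zeta L (u - α)) u :=
    hz1.fun_comp (f := fun u ↦ u - α) (by fun_prop)
  have e4 : AnalyticAt ℂ (fun u ↦ zeta L (u + α)) u :=
    hz2.fun_comp (f := fun u ↦ u + α) (by fun_prop)
  exact (e1.mul e2).mul ((analyticAt_const.mul (e3.add e4)).cexp')

lemma analyticAt_Phi {p q t α uφ uψ u : ℂ} (h1 : u - α ∉ L.lattice) (h2 : u + α ∉ L.lattice)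
    (i j : Fin 2) : AnalyticAt ℂ (fun v ↦ Phi L p q t α uφ uψ v i j) u := by
  have h3 : -u - α ∉ L.lattice := by
    rw [show -u - α = -(u + α) by ring, neg_mem_iff]
    exact h2
  have h4 : -u + α ∉ L.lattice := by
    rw [show -u + α = -(u - α) by ring, neg_mem_iff]
    exact h1
  have hneg : ∀ v, AnalyticAt ℂ (fun u ↦ entry L p q t α v (-u)) u := fun v ↦
    (analyticAt_entry hIm h3 h4).fun_comp (f := fun u ↦ -u) (by fun_prop)
  fin_cases i <;> fin_cases j
  · exact analyticAt_entry hIm h1 h2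
  · exact hneg uφ
  · exact analyticAt_entry hIm h1 h2
  · exact hneg uψ

end Phi

end MatrixPhi

section Curves

/-! ### The uniformization of the curve -/

section Uniformization

variable {e : Fin 3 → ℂ} {L : PeriodPair}

lemma isClosed_affineCurve (e : Fin 3 → ℂ) :
    IsClosed {Q : ℂ × ℂ | Q.2 ^ 2 = 4 * ∏ i, (Q.1 - e i)} :=
  isClosed_eq (by fun_prop) (by fun_prop)

/-- This makes the one-point compactification Hausdorff, as needed for uniqueness of limits on the
curve. -/
instance (e : Fin 3 → ℂ) : LocallyCompactSpace (AffineCurve e) :=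
  (isClosed_affineCurve e).isClosedEmbedding_subtypeVal.locallyCompactSpace

lemma AffineCurve.ext {Q R : AffineCurve e} (h1 : Q.1.1 = R.1.1) (h2 : Q.1.2 = R.1.2) : Q = R :=
  Subtype.ext (Prod.ext h1 h2)

/-- The coordinate `x` of the curve as a function of `u`. -/
noncomputable def xCoord (e : Fin 3 → ℂ) (L : PeriodPair) (u : ℂ) : ℂ :=
  (∑ i, e i) / 3 + L.weierstrassP u

lemma xCoord_eq_iff {z w : ℂ} (hz : z ∉ L.lattice) (hw : w ∉ L.lattice) :
    xCoord e L z = xCoord e L w ↔ z + w ∈ L.lattice ∨ z - w ∈ L.lattice := by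
  rw [← weierstrassP_eq_iff L hz hw, xCoord, xCoord, add_right_inj]

lemma analyticAt_xCoord {z : ℂ} (hz : z ∉ L.lattice) : AnalyticAt ℂ (xCoord e L) z :=
  analyticAt_const.add (L.analyticOnNhd_weierstrassP z hz)

lemma hasDerivAt_xCoord {z : ℂ} (hz : z ∉ L.lattice) :
    HasDerivAt (xCoord e L) (L.derivWeierstrassP z) z :=
  (hasDerivAt_weierstrassP L hz).const_add _

lemma derivWeierstrassP_sq_eq (hL : IsLatticeOf L e) {z : ℂ} (hz : z ∉ L.lattice) :
    L.derivWeierstrassP z ^ 2 = 4 * ∏ i, (xCoord e L z - e i) := by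
  rw [hL, L.derivWeierstrassP_sq z hz, xCoord]
  ring

open Classical in
/-- The affine part of the uniformization of the curve, with a junk value at the lattice. -/
noncomputable def affinePoint (hL : IsLatticeOf L e) (z : ℂ) : AffineCurve e :=
  if hz : z ∈ L.lattice then ⟨(e 0, 0), by simp [Fin.prod_univ_succ]⟩
  else ⟨(xCoord e L z, L.derivWeierstrassP z), derivWeierstrassP_sq_eq hL hz⟩

open Classical in
/-- The uniformization `u ↦ (x, y)` of the curve. -/
noncomputable def toCurve (hL : IsLatticeOf L e) (z : ℂ) : Curve e :=
  if z ∈ L.lattice then OnePoint.infty else (affinePoint hL z : Curve e)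

variable (hL : IsLatticeOf L e)
include hL

lemma affinePoint_fst {z : ℂ} (hz : z ∉ L.lattice) : (affinePoint hL z).1.1 = xCoord e L z := by
  simp [affinePoint, hz]

lemma affinePoint_snd {z : ℂ} (hz : z ∉ L.lattice) :
    (affinePoint hL z).1.2 = L.derivWeierstrassP z := by
  simp [affinePoint, hz]

lemma toCurve_of_mem {z : ℂ} (hz : z ∈ L.lattice) : toCurve hL z = OnePoint.infty := by
  simp [toCurve, hz]

lemma toCurve_of_notMem {z : ℂ} (hz : z ∉ L.lattice) :
    toCurve hL z = (affinePoint hL z : Curve e) := by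
  simp [toCurve, hz]

lemma toCurve_eq_infty_iff {z : ℂ} : toCurve hL z = OnePoint.infty ↔ z ∈ L.lattice := by
  by_cases hz : z ∈ L.lattice <;> simp [toCurve, hz]

lemma toCurve_eq_coe_iff {z : ℂ} {Q : AffineCurve e} : toCurve hL z = (Q : Curve e) ↔
    z ∉ L.lattice ∧ xCoord e L z = Q.1.1 ∧ L.derivWeierstrassP z = Q.1.2 := by
  by_cases hz : z ∈ L.lattice
  · simp [toCurve_of_mem hL hz, hz]
  · rw [toCurve_of_notMem hL hz, OnePoint.coe_eq_coe, ← affinePoint_fst hL hz,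
      ← affinePoint_snd hL hz]
    exact ⟨fun h ↦ h ▸ ⟨hz, rfl, rfl⟩, fun h ↦ AffineCurve.ext h.2.1 h.2.2⟩

lemma toCurve_add {z ω : ℂ} (hω : ω ∈ L.lattice) : toCurve hL (z + ω) = toCurve hL z := by
  by_cases hz : z ∈ L.lattice
  · rw [toCurve_of_mem hL hz, toCurve_of_mem hL ((add_mem_lattice_iff hω).2 hz)]
  · have hz' : z + ω ∉ L.lattice := by rwa [add_mem_lattice_iff hω]
    rw [toCurve_of_notMem hL hz, toCurve_eq_coe_iff, affinePoint_fst hL hz, affinePoint_snd hL hz,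
      xCoord, L.weierstrassP_add_coe z ⟨ω, hω⟩, L.derivWeierstrassP_add_coe z ⟨ω, hω⟩]
    exact ⟨hz', rfl, rfl⟩

/-- Equal `x` means `z ≡ ±w`. If `z ≡ -w`, then equal `y` gives `℘'(w) = 0`, so `2w ∈ Λ` and the two
signs agree. -/
lemma toCurve_eq_iff {z w : ℂ} : toCurve hL z = toCurve hL w ↔ z - w ∈ L.lattice := by
  refine ⟨fun h ↦ ?_, fun h ↦ ?_⟩
  · by_cases hw : w ∈ L.lattice
    · rw [toCurve_of_mem hL hw, toCurve_eq_infty_iff] at h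
      exact L.lattice.sub_mem h hw
    · rw [toCurve_of_notMem hL hw, toCurve_eq_coe_iff, affinePoint_fst hL hw,
        affinePoint_snd hL hw] at h
      obtain ⟨hz, h1, h2⟩ := h
      rcases (xCoord_eq_iff hz hw).1 h1 with h3 | h3
      · have h4 : L.derivWeierstrassP z = -L.derivWeierstrassP w := by
          rw [← L.derivWeierstrassP_neg w, show z = -w + (z + w) by ring,
            L.derivWeierstrassP_add_coe (-w) ⟨_, h3⟩]
        have h5 : L.derivWeierstrassP w = 0 := by
          have : 2 * L.derivWeierstrassP w = 0 := by linear_combination h4 - h2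
          simpa using this
        rw [derivWeierstrassP_eq_zero_iff L hw] at h5
        rw [show z - w = z + w - 2 * w by ring]
        exact L.lattice.sub_mem h3 h5
      · exact h3
  · rw [show z = w + (z - w) by ring, toCurve_add hL h]

lemma exists_toCurve_eq (P : Curve e) : ∃ z, toCurve hL z = P := by
  induction P using OnePoint.rec with
  | infty => exact ⟨0, toCurve_of_mem hL L.lattice.zero_mem⟩
  | coe Q =>
    obtain ⟨z, hz, hx⟩ := exists_weierstrassP_eq L (Q.1.1 - (∑ i, e i) / 3)
    have hx' : xCoord e L z = Q.1.1 := by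
      rw [xCoord, hx]
      ring
    have h1 := derivWeierstrassP_sq_eq hL hz
    rw [hx', ← Q.2, sq_eq_sq_iff_eq_or_eq_neg] at h1
    rcases h1 with h1 | h1
    · exact ⟨z, (toCurve_eq_coe_iff hL).2 ⟨hz, hx', h1⟩⟩
    · refine ⟨-z, (toCurve_eq_coe_iff hL).2 ⟨by simpa using hz, ?_, ?_⟩⟩
      · rw [← hx', xCoord, xCoord, L.weierstrassP_neg]
      · rw [L.derivWeierstrassP_neg, h1, neg_neg]

lemma continuousAt_affinePoint {z : ℂ} (hz : z ∉ L.lattice) :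
    ContinuousAt (affinePoint hL) z := by
  refine Topology.IsInducing.subtypeVal.continuousAt_iff.2 ?_
  have h1 : ContinuousAt (fun z ↦ (xCoord e L z, L.derivWeierstrassP z)) z :=
    (analyticAt_xCoord hz).continuousAt.prodMk (L.analyticOnNhd_derivWeierstrassP z hz).continuousAt
  refine h1.congr ?_
  filter_upwards [(isOpen_compl_lattice L).mem_nhds hz] with w hw
  exact Prod.ext (affinePoint_fst hL hw).symm (affinePoint_snd hL hw).symm

/-- At lattice points, `℘` tends to infinity while `x` is bounded on every compact part of the
affine curve. -/
lemma continuous_toCurve : Continuous (toCurve hL) := by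
  rw [continuous_iff_continuousAt]
  intro z
  by_cases hz : z ∈ L.lattice
  · rw [ContinuousAt, toCurve_of_mem hL hz, OnePoint.hasBasis_nhds_infty.tendsto_right_iff]
    rintro K ⟨-, hK⟩
    have hcont : Continuous fun Q : AffineCurve e ↦ Q.1.1 - (∑ i, e i) / 3 := by fun_prop
    obtain ⟨M, hM⟩ := hK.exists_bound_of_continuousOn hcont.continuousOn
    have h1 : Tendsto L.weierstrassP (𝓝[≠] z) (Bornology.cobounded ℂ) :=
      tendsto_cobounded_of_meromorphicOrderAt_neg (by
        rw [L.order_weierstrassP z hz]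
        decide)
    have h2 := (tendsto_norm_atTop_iff_cobounded.2 h1).eventually_gt_atTop M
    rw [eventually_nhdsWithin_iff] at h2
    filter_upwards [h2] with w hw
    by_cases hwl : w ∈ L.lattice
    · rw [toCurve_of_mem hL hwl]
      simp
    · refine Or.inl ⟨affinePoint hL w, fun hwK ↦ ?_, (toCurve_of_notMem hL hwl).symm⟩
      have h3 := hM _ hwK
      rw [affinePoint_fst hL hwl, xCoord, add_sub_cancel_left] at h3
      exact (hw (fun h ↦ hwl (by rw [h]; exact hz))).not_ge h3
  · have h1 : ContinuousAt (fun z ↦ (affinePoint hL z : Curve e)) z :=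
      OnePoint.continuous_coe.continuousAt.comp (continuousAt_affinePoint hL hz)
    refine h1.congr ?_
    filter_upwards [(isOpen_compl_lattice L).mem_nhds hz] with w hw
    exact (toCurve_of_notMem hL hw).symm

lemma toCurve_mem_branchPoints_iff {u : ℂ} :
    toCurve hL u ∈ branchPoints e ↔ 2 * u ∈ L.lattice := by
  by_cases hu : u ∈ L.lattice
  · have : 2 * u ∈ L.lattice := by
      rw [two_mul]
      exact L.lattice.add_mem hu hu
    simp only [this, iff_true]
    exact Or.inl (toCurve_of_mem hL hu)
  · rw [← derivWeierstrassP_eq_zero_iff L hu]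
    constructor
    · rintro (h | ⟨Q, hQ, i, hi⟩)
      · exact absurd ((toCurve_eq_infty_iff hL).1 h) hu
      · rw [((toCurve_eq_coe_iff hL).1 hQ).2.2, hi]
    · intro h
      refine Or.inr ⟨affinePoint hL u, toCurve_of_notMem hL hu, ?_⟩
      have h1 := derivWeierstrassP_sq_eq hL hu
      rw [h, zero_pow two_ne_zero, eq_comm, mul_eq_zero, or_iff_right (by norm_num),
        Finset.prod_eq_zero_iff] at h1
      obtain ⟨i, -, hi⟩ := h1
      refine ⟨i, Prod.ext ?_ ?_⟩
      · rw [affinePoint_fst hL hu]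
        exact sub_eq_zero.1 hi
      · rw [affinePoint_snd hL hu, h]

lemma liesOver_toCurve_iff {u a : ℂ} :
    LiesOver (toCurve hL u) a ↔ u ∉ L.lattice ∧ xCoord e L u = a := by
  constructor
  · rintro ⟨Q, hQ, rfl⟩
    have := (toCurve_eq_coe_iff hL).1 hQ
    exact ⟨this.1, this.2.1⟩
  · rintro ⟨hu, h⟩
    exact ⟨affinePoint hL u, toCurve_of_notMem hL hu, (affinePoint_fst hL hu).trans h⟩

omit hL in
lemma ncard_branchPoints (he : Function.Injective e) : (branchPoints e).ncard = 4 := by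
  set f : Fin 3 → Curve e := fun i ↦
    ((⟨(e i, 0), by simp [Finset.prod_eq_zero_iff, sub_eq_zero]⟩ : AffineCurve e) : Curve e) with hf
  have h1 : branchPoints e = insert OnePoint.infty (range f) := by
    ext P
    simp only [branchPoints, Set.mem_ofPred_eq, mem_insert_iff, mem_range]
    refine or_congr_right ⟨?_, ?_⟩
    · rintro ⟨Q, rfl, i, hi⟩
      exact ⟨i, congrArg _ (Subtype.ext hi.symm)⟩
    · rintro ⟨i, rfl⟩
      exact ⟨_, rfl, i, rfl⟩
  have hinj : Function.Injective f := by
    intro i j hij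
    have := congrArg (fun Q : AffineCurve e ↦ Q.1.1) (OnePoint.coe_injective hij)
    exact he this
  rw [h1, ncard_insert_of_notMem, ← image_univ, ncard_image_of_injective _ hinj, ncard_univ]
  · simp
  · simp [hf]

omit hL in
/-- The coordinate `x` has a local inverse at the points which are not branch points. -/
lemma exists_localInverse_xCoord {z : ℂ} (hz : z ∉ L.lattice) (hd : L.derivWeierstrassP z ≠ 0) :
    ∃ g : ℂ → ℂ, AnalyticAt ℂ g (xCoord e L z) ∧ (∀ᶠ w in 𝓝 z, g (xCoord e L w) = w) ∧
      ∀ᶠ x in 𝓝 (xCoord e L z), xCoord e L (g x) = x := by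
  have ha : AnalyticAt ℂ (xCoord e L) z := analyticAt_xCoord hz
  have hd' : deriv (xCoord e L) z ≠ 0 := by
    rw [(hasDerivAt_xCoord hz).deriv]
    exact hd
  exact ⟨_, ha.analyticAt_localInverse hd', HasStrictDerivAt.eventually_left_inverse _ hd',
    HasStrictDerivAt.eventually_right_inverse _ hd'⟩

end Uniformization

end Curves

section AbelMap

/-! ### Paths on the curve and their lifts -/

/-- Countably many curves do not fill the plane. -/
lemma exists_forall_ne_of_contDiffOn {B : Set ℂ} (hB : B.Countable) {S : Set ℝ} (hS : Convex ℝ S)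
    {F : ℂ → ℝ → ℂ} (hF : ∀ b ∈ B, ContDiffOn ℝ 1 (F b) S) : ∃ k, ∀ b ∈ B, ∀ s ∈ S, F b s ≠ k := by
  -- Each image under a `C¹` map has Hausdorff dimension at most `1`, and so has a countable union
  -- of them; the plane has dimension `2`.
  have h1 : dimH (⋃ b ∈ B, F b '' S) < Module.finrank ℝ ℂ := by
    rw [dimH_bUnion hB, Complex.finrank_real_complex]
    refine lt_of_le_of_lt (iSup₂_le fun b hb ↦ ?_) (by norm_num : (1 : ENNReal) < (2 : ℕ))
    refine ((hF b hb).dimH_image_le hS Subset.rfl).trans ?_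
    rw [← Real.dimH_univ]
    exact dimH_mono (subset_univ S)
  obtain ⟨k, hk⟩ := (dense_compl_of_dimH_lt_finrank h1).nonempty
  refine ⟨k, fun b hb s hs h ↦ hk ?_⟩
  exact mem_iUnion₂.2 ⟨b, hb, s, hs, h⟩

section Paths

variable {e : Fin 3 → ℂ} {L : PeriodPair} (hL : IsLatticeOf L e)
include hL

omit hL in
lemma notMem_of_two_mul_notMem {z : ℂ} (hz : 2 * z ∉ L.lattice) : z ∉ L.lattice := by
  intro h
  rw [two_mul] at hz
  exact hz (L.lattice.add_mem h h)

lemma hasDerivAt_affinePoint_fst {z : ℝ → ℂ} {z' : ℂ} {s : ℝ} (hz : z s ∉ L.lattice)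
    (hd : HasDerivAt z z' s) :
    HasDerivAt (fun s ↦ (affinePoint hL (z s)).1.1) (L.derivWeierstrassP (z s) * z') s := by
  have h1 := (hasDerivAt_xCoord (e := e) hz).comp s hd
  refine h1.congr_of_eventuallyEq ?_
  filter_upwards [hd.continuousAt.eventually ((isOpen_compl_lattice L).mem_nhds hz)] with r hr
  exact affinePoint_fst hL hr

lemma contDiffAt_affinePoint_fst {z : ℝ → ℂ} {s : ℝ} (hz : z s ∉ L.lattice)
    (hd : ContDiffAt ℝ 1 z s) :
    ContDiffAt ℝ 1 (fun s ↦ (affinePoint hL (z s)).1.1) s := by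
  have h0 : ContDiffAt ℝ 1 (xCoord e L) (z s) :=
    ((analyticAt_xCoord hz).contDiffAt (n := 1)).restrict_scalars ℝ
  refine (h0.comp s hd).congr_of_eventuallyEq ?_
  filter_upwards [hd.continuousAt.eventually ((isOpen_compl_lattice L).mem_nhds hz)] with r hr
  exact affinePoint_fst hL hr

lemma affinePoint_snd_ne_zero {z : ℂ} (hz : 2 * z ∉ L.lattice) : (affinePoint hL z).1.2 ≠ 0 := by
  have hz' := notMem_of_two_mul_notMem hz
  rw [affinePoint_snd hL hz', Ne, derivWeierstrassP_eq_zero_iff L hz']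
  exact hz

/-- `dx / y = ℘'(z) dz / ℘'(z) = dz`. -/
lemma abelIntegral_affinePoint {z z' : ℝ → ℂ} {r₁ r₂ : ℝ}
    (hz : ∀ s ∈ uIcc r₁ r₂, 2 * z s ∉ L.lattice)
    (hd : ∀ s ∈ uIcc r₁ r₂, HasDerivAt z (z' s) s) (hz' : Continuous z') :
    abelIntegral (fun s ↦ affinePoint hL (z s)) r₁ r₂ = z r₂ - z r₁ := by
  rw [← intervalIntegral.integral_eq_sub_of_hasDerivAt hd (hz'.intervalIntegrable _ _),
    abelIntegral]
  refine intervalIntegral.integral_congr fun s hs ↦ ?_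
  have h1 := notMem_of_two_mul_notMem (hz s hs)
  have h2 := affinePoint_snd_ne_zero hL (hz s hs)
  rw [(hasDerivAt_affinePoint_fst hL h1 (hd s hs)).deriv, ← affinePoint_snd hL h1,
    mul_div_cancel_left₀ _ h2]

/-- The segment from `0` to `u` may meet half-periods, that is, branch points. It is bent to `su +
s(1 - s)k`, with `k` off the countably many curves of values that would produce such a meeting. -/
lemma isAbelValue_toCurve (u : ℂ) : IsAbelValue e (toCurve hL u) u := by
  have hB : {w : ℂ | 2 * w ∈ L.lattice}.Countable :=
    (countable_lattice L).preimage (mul_right_injective₀ (two_ne_zero' ℂ))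
  have hpos : ∀ s ∈ Ioo (0 : ℝ) 1, ((s : ℂ) * (1 - s)) ≠ 0 := by
    intro s hs
    refine mul_ne_zero (by exact_mod_cast hs.1.ne') (sub_ne_zero.2 ?_)
    exact_mod_cast hs.2.ne'
  have hofReal : ContDiff ℝ 1 (fun s : ℝ ↦ (s : ℂ)) := Complex.ofRealCLM.contDiff
  obtain ⟨k, hk⟩ := exists_forall_ne_of_contDiffOn hB (convex_Ioo (0 : ℝ) 1)
    (F := fun b s ↦ (b - (s : ℂ) * u) * ((s : ℂ) * (1 - (s : ℂ)))⁻¹) (fun b _ ↦ by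
      refine ContDiffOn.mul ?_ (ContDiffOn.inv ?_ hpos)
      · exact (contDiff_const.sub (hofReal.mul contDiff_const)).contDiffOn
      · exact (hofReal.mul (contDiff_const.sub hofReal)).contDiffOn)
  set z : ℝ → ℂ := fun s ↦ s * u + s * (1 - s) * k with hzdef
  have hz : ∀ s ∈ Ioo (0 : ℝ) 1, 2 * z s ∉ L.lattice := by
    intro s hs h
    refine hk (z s) h s hs ?_
    rw [← div_eq_mul_inv, div_eq_iff (hpos s hs), hzdef]
    ring
  have hzsmooth : ContDiff ℝ 1 z :=
    (hofReal.mul contDiff_const).add ((hofReal.mul (contDiff_const.sub hofReal)).mul contDiff_const)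
  have hz0 : ∀ s ∈ Ioo (0 : ℝ) 1, z s ∉ L.lattice := fun s hs ↦
    notMem_of_two_mul_notMem (hz s hs)
  have hcoe : ∀ s ∈ Ioo (0 : ℝ) 1, toCurve hL (z s) = (affinePoint hL (z s) : Curve e) :=
    fun s hs ↦ toCurve_of_notMem hL (hz0 s hs)
  have hcont : Continuous fun s ↦ toCurve hL (z s) :=
    (continuous_toCurve hL).comp hzsmooth.continuous
  refine ⟨fun s ↦ affinePoint hL (z s), fun s hs ↦ ?_, fun s hs ↦ ?_, fun s hs ↦ ?_, ?_, ?_, ?_⟩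
  · exact ((continuousAt_affinePoint hL (hz0 s hs)).comp
      hzsmooth.continuous.continuousAt).continuousWithinAt
  · exact (contDiffAt_affinePoint_fst hL (hz0 s hs) hzsmooth.contDiffAt).contDiffWithinAt
  · exact affinePoint_snd_ne_zero hL (hz s hs)
  · have h1 := hcont.tendsto 0
    rw [show z 0 = 0 by simp [hzdef], toCurve_of_mem hL L.lattice.zero_mem] at h1
    refine (h1.mono_left nhdsWithin_le_nhds).congr' ?_
    filter_upwards [Ioo_mem_nhdsGT (zero_lt_one' ℝ)] with s hs
    exact hcoe s hs
  · have h1 := hcont.tendsto 1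
    rw [show z 1 = u by simp [hzdef]] at h1
    refine (h1.mono_left nhdsWithin_le_nhds).congr' ?_
    filter_upwards [Ioo_mem_nhdsLT (zero_lt_one' ℝ)] with s hs
    exact hcoe s hs
  · have h1 : Tendsto (fun r : ℝ × ℝ ↦ z r.2 - z r.1) (𝓝 ((0 : ℝ), (1 : ℝ))) (𝓝 (z 1 - z 0)) :=
      Continuous.tendsto (f := fun r : ℝ × ℝ ↦ z r.2 - z r.1)
        ((hzsmooth.continuous.comp continuous_snd).sub (hzsmooth.continuous.comp continuous_fst))
        ((0 : ℝ), (1 : ℝ))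
    rw [show z 1 - z 0 = u by simp [hzdef], nhds_prod_eq] at h1
    refine (h1.mono_left (prod_mono nhdsWithin_le_nhds nhdsWithin_le_nhds)).congr' ?_
    filter_upwards [prod_mem_prod (Ioo_mem_nhdsGT (zero_lt_one' ℝ))
      (Ioo_mem_nhdsLT (zero_lt_one' ℝ))] with r hr
    have hsub : uIcc r.1 r.2 ⊆ Ioo (0 : ℝ) 1 := ordConnected_Ioo.uIcc_subset hr.1 hr.2
    refine (abelIntegral_affinePoint hL (z' := deriv z) (fun s hs ↦ hz s (hsub hs))
      (fun s _ ↦ (hzsmooth.differentiable one_ne_zero s).hasDerivAt)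
      (hzsmooth.continuous_deriv le_rfl)).symm

/-- The image of a segment from `k` to `k + ω`, with `k` chosen such that the segment avoids the
half-periods and the points `±α + Λ` above `a`. -/
lemma exists_cycle {ω : ℂ} (hω : ω ∈ L.lattice) (a : ℂ) : ∃ c : ℝ → AffineCurve e, IsCycle c ∧
    (∀ s ∈ Icc (0 : ℝ) 1, (c s).1.1 ≠ a) ∧ abelIntegral c 0 1 = ω := by
  obtain ⟨α, hα⟩ : ∃ α, ∀ z, z ∉ L.lattice → xCoord e L z = a →
      z + α ∈ L.lattice ∨ z - α ∈ L.lattice := by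
    by_cases h : ∃ α, α ∉ L.lattice ∧ xCoord e L α = a
    · obtain ⟨α, hα, rfl⟩ := h
      exact ⟨α, fun z hz h ↦ (xCoord_eq_iff hz hα).1 h⟩
    · exact ⟨0, fun z hz hza ↦ absurd ⟨z, hz, hza⟩ h⟩
  have hB : ({w : ℂ | 2 * w ∈ L.lattice} ∪ ({w | w + α ∈ L.lattice} ∪
      {w | w - α ∈ L.lattice})).Countable :=
    ((countable_lattice L).preimage (mul_right_injective₀ (two_ne_zero' ℂ))).union
      (((countable_lattice L).preimage (add_left_injective α)).union
        ((countable_lattice L).preimage sub_left_injective))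
  have hofReal : ContDiff ℝ 1 (fun s : ℝ ↦ (s : ℂ)) := Complex.ofRealCLM.contDiff
  obtain ⟨k, hk⟩ := exists_forall_ne_of_contDiffOn hB (convex_univ (𝕜 := ℝ) (E := ℝ))
    (F := fun b s ↦ b - s * ω)
    (fun b _ ↦ (contDiff_const.sub (hofReal.mul contDiff_const)).contDiffOn)
  set z : ℝ → ℂ := fun s ↦ k + s * ω with hzdef
  have hzB : ∀ s, z s ∉ ({w : ℂ | 2 * w ∈ L.lattice} ∪ ({w | w + α ∈ L.lattice} ∪
      {w | w - α ∈ L.lattice})) := by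
    intro s h
    refine hk (z s) h s (mem_univ s) ?_
    rw [hzdef]
    ring
  have hz : ∀ s, 2 * z s ∉ L.lattice := fun s h ↦ hzB s (Or.inl h)
  have hz0 : ∀ s, z s ∉ L.lattice := fun s ↦ notMem_of_two_mul_notMem (hz s)
  have hzsmooth : ContDiff ℝ 1 z := contDiff_const.add (hofReal.mul contDiff_const)
  refine ⟨fun s ↦ affinePoint hL (z s), ⟨fun s hs ↦ ?_, fun s hs ↦ ?_, fun s hs ↦ ?_, ?_⟩,
    fun s hs h ↦ ?_, ?_⟩
  · exact ((continuousAt_affinePoint hL (hz0 s)).comp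
      hzsmooth.continuous.continuousAt).continuousWithinAt
  · exact (contDiffAt_affinePoint_fst hL (hz0 s) hzsmooth.contDiffAt).contDiffWithinAt
  · exact affinePoint_snd_ne_zero hL (hz s)
  · have h1 : toCurve hL (z 0) = toCurve hL (z 1) := by
      rw [toCurve_eq_iff, hzdef]
      simpa using hω
    rw [toCurve_of_notMem hL (hz0 0), toCurve_of_notMem hL (hz0 1)] at h1
    exact OnePoint.coe_injective h1
  · rw [affinePoint_fst hL (hz0 s)] at h
    exact hzB s (Or.inr (hα (z s) (hz0 s) h))
  · rw [abelIntegral_affinePoint hL (z' := deriv z) (fun s _ ↦ hz s)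
      (fun s _ ↦ (hzsmooth.differentiable one_ne_zero s).hasDerivAt)
      (hzsmooth.continuous_deriv le_rfl)]
    simp [hzdef]

/-- A primitive of `dx / y` along a path is a lift of the path if it is so at one point. -/
lemma toCurve_eq_of_hasDerivAt {c : ℝ → AffineCurve e} (hc : ContinuousOn c (Ioo 0 1))
    (hx : ContDiffOn ℝ 1 (fun s ↦ (c s).1.1) (Ioo 0 1)) (hy : ∀ s ∈ Ioo (0 : ℝ) 1, (c s).1.2 ≠ 0)
    {z : ℝ → ℂ}
    (hz : ∀ s ∈ Ioo (0 : ℝ) 1, HasDerivAt z (deriv (fun s ↦ (c s).1.1) s / (c s).1.2) s)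
    {s₀ : ℝ} (hs₀ : s₀ ∈ Ioo (0 : ℝ) 1) (h₀ : toCurve hL (z s₀) = c s₀) :
    ∀ s ∈ Ioo (0 : ℝ) 1, toCurve hL (z s) = c s := by
  -- The set of times at which `z` lifts `c` is open and closed in the interval. For openness, `z`
  -- is compared with the local lift given by a local inverse of the coordinate `x`.
  set U : Set ℝ := {s | s ∈ Ioo (0 : ℝ) 1 ∧ toCurve hL (z s) = c s} with hU
  have hzc : ContinuousOn z (Ioo 0 1) := fun s hs ↦ (hz s hs).continuousAt.continuousWithinAt
  have hUopen : IsOpen U := by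
    rw [isOpen_iff_mem_nhds]
    rintro s₁ ⟨hs₁, h₁⟩
    have hI : Ioo (0 : ℝ) 1 ∈ 𝓝 s₁ := Ioo_mem_nhds hs₁.1 hs₁.2
    obtain ⟨hzl, hX, hY⟩ := (toCurve_eq_coe_iff hL).1 h₁
    have hd : L.derivWeierstrassP (z s₁) ≠ 0 := by
      rw [hY]
      exact hy s₁ hs₁
    obtain ⟨g, hg, hgl, hgr⟩ := exists_localInverse_xCoord (e := e) hzl hd
    have hgz : g (xCoord e L (z s₁)) = z s₁ := hgl.self_of_nhds
    rw [hX] at hg hgr hgz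
    have hcx : ContinuousAt (fun s ↦ (c s).1.1) s₁ := (hx.continuousOn).continuousAt hI
    have hcc : ContinuousAt c s₁ := hc.continuousAt hI
    have hcy : ContinuousAt (fun s ↦ (c s).1.2) s₁ :=
      (continuous_snd.comp continuous_subtype_val).continuousAt.comp hcc
    set h : ℝ → ℂ := fun s ↦ g (c s).1.1 with hh
    have hhc : ContinuousAt h s₁ := ContinuousAt.comp (g := g) hg.continuousAt hcx
    have hhz : h s₁ = z s₁ := hgz
    have hsum : ContinuousAt (fun s ↦ L.derivWeierstrassP (h s) + (c s).1.2) s₁ := by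
      have : ContinuousAt L.derivWeierstrassP (h s₁) := by
        rw [hhz]
        exact (L.analyticOnNhd_derivWeierstrassP _ hzl).continuousAt
      exact (this.comp hhc).add hcy
    -- The equation of the curve determines `y` up to sign; near `s₁` the wrong sign is excluded
    -- because `℘'(h) + y` stays away from zero.
    have hsum0 : L.derivWeierstrassP (h s₁) + (c s₁).1.2 ≠ 0 := by
      rw [hhz, hY, ← two_mul]
      exact mul_ne_zero two_ne_zero (hy s₁ hs₁)
    have hev : ∀ᶠ s in 𝓝 s₁, s ∈ Ioo (0 : ℝ) 1 ∧ toCurve hL (h s) = c s ∧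
        AnalyticAt ℂ g (c s).1.1 := by
      filter_upwards [hI, hcx.eventually hgr, hcx.eventually hg.eventually_analyticAt,
        hsum.eventually_ne hsum0, hhc.eventually (by
          rw [hhz]
          exact (isOpen_compl_lattice L).mem_nhds hzl)] with s hs e1 e2 e3 e4
      refine ⟨hs, (toCurve_eq_coe_iff hL).2 ⟨e4, e1, ?_⟩, e2⟩
      have h1 := derivWeierstrassP_sq_eq hL e4
      rw [e1, ← (c s).2, sq_eq_sq_iff_eq_or_eq_neg] at h1
      refine h1.resolve_right fun h2 ↦ e3 ?_
      rw [h2, neg_add_cancel]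
    obtain ⟨ε, hε, hball⟩ := Metric.eventually_nhds_iff_ball.1 hev
    have hderiv : ∀ s ∈ Metric.ball s₁ ε, HasDerivAt (fun s ↦ h s - z s) 0 s := by
      intro s hs
      obtain ⟨hsI, hsc, hsg⟩ := hball s hs
      obtain ⟨hl, hsX, hsY⟩ := (toCurve_eq_coe_iff hL).1 hsc
      have hxd : HasDerivAt (fun s ↦ (c s).1.1) (deriv (fun s ↦ (c s).1.1) s) s :=
        ((hx.differentiableOn one_ne_zero).differentiableAt (Ioo_mem_nhds hsI.1 hsI.2)).hasDerivAt
      have hhd : HasDerivAt h (deriv g (c s).1.1 * deriv (fun s ↦ (c s).1.1) s) s :=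
        hsg.differentiableAt.hasDerivAt.comp s hxd
      have hXh : HasDerivAt (fun s ↦ xCoord e L (h s))
          (L.derivWeierstrassP (h s) * (deriv g (c s).1.1 * deriv (fun s ↦ (c s).1.1) s)) s :=
        (hasDerivAt_xCoord (e := e) hl).comp s hhd
      have heq : (fun s ↦ xCoord e L (h s)) =ᶠ[𝓝 s] fun s ↦ (c s).1.1 := by
        filter_upwards [Metric.isOpen_ball.mem_nhds hs] with r hr
        exact ((toCurve_eq_coe_iff hL).1 (hball r hr).2.1).2.1
      have huniq := (hxd.congr_of_eventuallyEq heq).unique hXh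
      have h1 := hhd.sub (hz s hsI)
      rw [hsY] at huniq
      convert! h1 using 1
      rw [eq_comm, sub_eq_zero, eq_div_iff (hy s hsI), mul_comm, ← huniq]
    have hhz' : ∀ s ∈ Metric.ball s₁ ε, h s = z s := by
      intro s hs
      have := Metric.isOpen_ball.is_const_of_deriv_eq_zero
        (Metric.isConnected_ball hε).isPreconnected
        (fun r hr ↦ (hderiv r hr).differentiableAt.differentiableWithinAt)
        (fun r hr ↦ (hderiv r hr).deriv) hs (Metric.mem_ball_self hε)
      rw [hhz, sub_self] at this
      exact sub_eq_zero.1 this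
    filter_upwards [Metric.isOpen_ball.mem_nhds (Metric.mem_ball_self hε)] with s hs
    obtain ⟨hsI, hsc, -⟩ := hball s hs
    exact ⟨hsI, by rw [← hhz' s hs, hsc]⟩
  have hsub : Ioo (0 : ℝ) 1 ⊆ U := by
    refine isPreconnected_Ioo.subset_of_closure_inter_subset hUopen ⟨s₀, hs₀, hs₀, h₀⟩ ?_
    rintro s ⟨hs, hsI⟩
    refine ⟨hsI, ?_⟩
    have hI : Ioo (0 : ℝ) 1 ∈ 𝓝 s := Ioo_mem_nhds hsI.1 hsI.2
    have h1 : Tendsto (fun s ↦ toCurve hL (z s)) (𝓝[U] s) (𝓝 (toCurve hL (z s))) :=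
      ((continuous_toCurve hL).continuousAt.comp (hzc.continuousAt hI)).tendsto.mono_left
        nhdsWithin_le_nhds
    have h2 : Tendsto (fun s ↦ (c s : Curve e)) (𝓝[U] s) (𝓝 (c s : Curve e)) :=
      (OnePoint.continuous_coe.continuousAt.comp (hc.continuousAt hI)).tendsto.mono_left
        nhdsWithin_le_nhds
    have : (𝓝[U] s).NeBot := mem_closure_iff_nhdsWithin_neBot.1 hs
    refine tendsto_nhds_unique (h1.congr' ?_) h2
    filter_upwards [self_mem_nhdsWithin] with r hr
    exact hr.2
  exact fun s hs ↦ (hsub hs).2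

/-- Lifts of paths. -/
lemma exists_lift {c : ℝ → AffineCurve e} (hc : ContinuousOn c (Ioo 0 1))
    (hx : ContDiffOn ℝ 1 (fun s ↦ (c s).1.1) (Ioo 0 1))
    (hy : ∀ s ∈ Ioo (0 : ℝ) 1, (c s).1.2 ≠ 0) :
    ∃ z₀ : ℂ, (∀ s ∈ Ioo (0 : ℝ) 1, toCurve hL (z₀ + abelIntegral c (1 / 2) s) = c s) ∧
      ∀ r₁ ∈ Ioo (0 : ℝ) 1, ∀ r₂ ∈ Ioo (0 : ℝ) 1,
        abelIntegral c r₁ r₂ = abelIntegral c (1 / 2) r₂ - abelIntegral c (1 / 2) r₁ := by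
  -- The path is controlled only on the open interval, so the primitive is based at an interior
  -- time.
  have hhalf : (1 / 2 : ℝ) ∈ Ioo (0 : ℝ) 1 := by norm_num
  obtain ⟨z₀, hz₀⟩ := exists_toCurve_eq hL (c (1 / 2) : Curve e)
  have hcy : ContinuousOn (fun s ↦ (c s).1.2) (Ioo 0 1) :=
    (continuous_snd.comp continuous_subtype_val).comp_continuousOn hc
  have hcont : ContinuousOn (fun s ↦ deriv (fun s ↦ (c s).1.1) s / (c s).1.2) (Ioo 0 1) :=
    (hx.continuousOn_deriv_of_isOpen isOpen_Ioo le_rfl).div hcy hy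
  have hint : ∀ r₁ ∈ Ioo (0 : ℝ) 1, ∀ r₂ ∈ Ioo (0 : ℝ) 1, IntervalIntegrable
      (fun s ↦ deriv (fun s ↦ (c s).1.1) s / (c s).1.2) MeasureTheory.volume r₁ r₂ :=
    fun r₁ h₁ r₂ h₂ ↦ (hcont.mono (ordConnected_Ioo.uIcc_subset h₁ h₂)).intervalIntegrable
  refine ⟨z₀, toCurve_eq_of_hasDerivAt hL hc hx hy (fun s hs ↦ ?_) hhalf ?_, ?_⟩
  · exact (intervalIntegral.integral_hasDerivAt_right (hint _ hhalf s hs)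
      (hcont.stronglyMeasurableAtFilter isOpen_Ioo s hs)
      (hcont.continuousAt (Ioo_mem_nhds hs.1 hs.2))).const_add z₀
  · simp only [abelIntegral, intervalIntegral.integral_same, add_zero]
    exact hz₀
  · intro r₁ h₁ r₂ h₂
    exact (intervalIntegral.integral_interval_sub_left (hint _ hhalf r₂ h₂)
      (hint _ hhalf r₁ h₁)).symm

omit hL in
/-- If a difference has a limit, then the two terms have limits. -/
lemma exists_tendsto_of_tendsto_sub {l₁ l₂ : Filter ℝ} [l₁.NeBot] [l₂.NeBot] {z : ℝ → ℂ} {u : ℂ}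
    (h : Tendsto (fun r : ℝ × ℝ ↦ z r.2 - z r.1) (l₁ ×ˢ l₂) (𝓝 u)) :
    ∃ A, Tendsto z l₁ (𝓝 A) ∧ Tendsto z l₂ (𝓝 (A + u)) := by
  have hC : Cauchy (map z l₁) := by
    rw [Metric.cauchy_iff]
    refine ⟨inferInstance, fun ε hε ↦ ?_⟩
    -- With one time `r` fixed near the other end, two values of `z` are compared through `z r`,
    -- which gives the Cauchy property.
    obtain ⟨p, hp, q, hq, hpq⟩ := eventually_prod_iff.1
      (Metric.tendsto_nhds.1 h (ε / 2) (by positivity))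
    obtain ⟨r, hr⟩ := hq.exists
    refine ⟨z '' {x | p x}, image_mem_map hp, ?_⟩
    rintro _ ⟨x, hx, rfl⟩ _ ⟨y, hy, rfl⟩
    have h1 := hpq hx hr
    have h2 := hpq hy hr
    simp only [dist_eq_norm] at h1 h2 ⊢
    calc ‖z x - z y‖ = ‖(z r - z y - u) - (z r - z x - u)‖ := by congr 1; ring
      _ ≤ ‖z r - z y - u‖ + ‖z r - z x - u‖ := norm_sub_le _ _
      _ < ε := by linarith
  obtain ⟨A, hA⟩ := CompleteSpace.complete hC
  refine ⟨A, hA, ?_⟩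
  have hA' : Tendsto (fun r : ℝ × ℝ ↦ z r.1) (l₁ ×ˢ l₂) (𝓝 A) :=
    (show Tendsto z l₁ (𝓝 A) from hA).comp tendsto_fst
  have h2 := hA'.add h
  simp only [add_sub_cancel] at h2
  have h3 : Tendsto z (map Prod.snd (l₁ ×ˢ l₂)) (𝓝 (A + u)) := h2
  rwa [map_snd_prod] at h3

/-- Convergence of the improper integral gives the lift limits `A` and `A + u` at its ends. The path
starts at `∞`, so `A ∈ Λ`, and `u` lies above the end point. -/
lemma toCurve_eq_of_isAbelValue {P : Curve e} {u : ℂ} (h : IsAbelValue e P u) :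
    toCurve hL u = P := by
  obtain ⟨c, hc, hx, hy, h0, h1, hu⟩ := h
  obtain ⟨z₀, hz, hint⟩ := exists_lift hL hc hx hy
  set z : ℝ → ℂ := fun s ↦ z₀ + abelIntegral c (1 / 2) s with hzdef
  have hI0 : Ioo (0 : ℝ) 1 ∈ 𝓝[>] (0 : ℝ) := Ioo_mem_nhdsGT zero_lt_one
  have hI1 : Ioo (0 : ℝ) 1 ∈ 𝓝[<] (1 : ℝ) := Ioo_mem_nhdsLT zero_lt_one
  obtain ⟨A, hA0, hA1⟩ := exists_tendsto_of_tendsto_sub (z := z) (hu.congr' (by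
    filter_upwards [prod_mem_prod hI0 hI1] with r hr
    rw [hint r.1 hr.1 r.2 hr.2, hzdef]
    ring))
  have hA : A ∈ L.lattice := by
    rw [← toCurve_eq_infty_iff hL]
    refine tendsto_nhds_unique (((continuous_toCurve hL).tendsto A).comp hA0) (h0.congr' ?_)
    filter_upwards [hI0] with s hs
    exact (hz s hs).symm
  have hP : toCurve hL (A + u) = P := by
    refine tendsto_nhds_unique (((continuous_toCurve hL).tendsto (A + u)).comp hA1) (h1.congr' ?_)
    filter_upwards [hI1] with s hs
    exact (hz s hs).symm
  rw [← hP, add_comm, toCurve_add hL hA]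

lemma isAbelValue_iff {P : Curve e} {u : ℂ} : IsAbelValue e P u ↔ toCurve hL u = P :=
  ⟨toCurve_eq_of_isAbelValue hL, fun h ↦ h ▸ isAbelValue_toCurve hL u⟩

lemma exists_lift_of_isCycle {c : ℝ → AffineCurve e} (hc : IsCycle c) :
    ∃ z : ℝ → ℂ, ContinuousOn z (Icc 0 1) ∧ (∀ s ∈ Icc (0 : ℝ) 1, toCurve hL (z s) = c s) ∧
      abelIntegral c 0 1 = z 1 - z 0 := by
  obtain ⟨hc, hx, hy, -⟩ := hc
  obtain ⟨z₀, hz, -⟩ := exists_lift hL (hc.mono Ioo_subset_Icc_self) (hx.mono Ioo_subset_Icc_self)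
    (fun s hs ↦ hy s (Ioo_subset_Icc_self hs))
  have hcy : ContinuousOn (fun s ↦ (c s).1.2) (Icc 0 1) :=
    (continuous_snd.comp continuous_subtype_val).comp_continuousOn hc
  have hint : IntervalIntegrable (fun s ↦ deriv (fun s ↦ (c s).1.1) s / (c s).1.2)
      MeasureTheory.volume 0 1 := by
    -- At the ends of the interval `deriv` may be a default value. The one-sided `derivWithin` is
    -- continuous up to the ends and agrees with it inside.
    have h1 : IntervalIntegrable
        (fun s ↦ derivWithin (fun s ↦ (c s).1.1) (Icc 0 1) s / (c s).1.2)
        MeasureTheory.volume 0 1 := by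
      refine ContinuousOn.intervalIntegrable ?_
      rw [uIcc_of_le zero_le_one]
      exact (hx.continuousOn_derivWithin (uniqueDiffOn_Icc zero_lt_one) le_rfl).div hcy hy
    refine h1.congr_uIoo fun s hs ↦ ?_
    rw [uIoo_of_le zero_le_one] at hs
    simp only
    rw [derivWithin_of_mem_nhds (Icc_mem_nhds hs.1 hs.2)]
  have hhalf : (1 / 2 : ℝ) ∈ uIcc (0 : ℝ) 1 := by
    rw [uIcc_of_le zero_le_one]
    norm_num
  have hzc : ContinuousOn (fun s ↦ z₀ + abelIntegral c (1 / 2) s) (Icc 0 1) := by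
    have := intervalIntegral.continuousOn_primitive_interval' hint hhalf
    rw [uIcc_of_le zero_le_one] at this
    exact continuousOn_const.add this
  refine ⟨_, hzc, ?_, ?_⟩
  · have h1 : EqOn (fun s ↦ toCurve hL (z₀ + abelIntegral c (1 / 2) s)) (fun s ↦ (c s : Curve e))
        (Ioo 0 1) := hz
    refine h1.of_subset_closure ((continuous_toCurve hL).comp_continuousOn hzc)
      (OnePoint.continuous_coe.comp_continuousOn hc) Ioo_subset_Icc_self ?_
    rw [closure_Ioo zero_ne_one]
  · rw [add_sub_add_left_eq_sub]
    refine (intervalIntegral.integral_interval_sub_left (hint.mono_set ?_) (hint.mono_set ?_)).symm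
    · exact uIcc_subset_uIcc hhalf right_mem_uIcc
    · exact uIcc_subset_uIcc hhalf left_mem_uIcc

/-- The lift of a cycle, with given initial point. -/
lemma exists_lift_of_isCycle_of_eq {c : ℝ → AffineCurve e} (hc : IsCycle c) {u : ℂ}
    (hu : toCurve hL u = c 0) :
    ∃ z : ℝ → ℂ, ContinuousOn z (Icc 0 1) ∧ (∀ s ∈ Icc (0 : ℝ) 1, toCurve hL (z s) = c s) ∧
      z 0 = u ∧ z 1 = u + abelIntegral c 0 1 := by
  obtain ⟨z, hz, hzc, hint⟩ := exists_lift_of_isCycle hL hc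
  have h0 : u - z 0 ∈ L.lattice := by
    rw [← toCurve_eq_iff hL, hu, hzc 0 (by simp)]
  refine ⟨fun s ↦ z s + (u - z 0), hz.add continuousOn_const, fun s hs ↦ ?_, by ring, ?_⟩
  · rw [toCurve_add hL h0, hzc s hs]
  · rw [hint]
    ring

lemma periods_eq (a : ℂ) : {ω | ∃ c : ℝ → AffineCurve e, IsCycle c ∧
    (∀ s ∈ Icc (0 : ℝ) 1, (c s).1.1 ≠ a) ∧ abelIntegral c 0 1 = ω} = (L.lattice : Set ℂ) := by
  ext ω
  constructor
  · rintro ⟨c, hc, -, rfl⟩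
    obtain ⟨z, -, hz, hint⟩ := exists_lift_of_isCycle hL hc
    rw [hint, SetLike.mem_coe, ← toCurve_eq_iff hL, hz 0 (by simp), hz 1 (by simp), hc.2.2.2]
  · exact fun hω ↦ exists_cycle hL hω a

end Paths

end AbelMap

/-! ### Analytic continuation along cycles -/

section Continuation

variable {e : Fin 3 → ℂ} {L : PeriodPair}

lemma xCoord_add {ω : ℂ} (hω : ω ∈ L.lattice) (z : ℂ) :
    xCoord e L (z + ω) = xCoord e L z := by
  rw [xCoord, L.weierstrassP_add_coe z ⟨ω, hω⟩, xCoord]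

/-- A continuous right inverse of the coordinate is a given local left inverse. -/
lemma eventuallyEq_localInverse {g h : ℂ → ℂ} {x : ℂ} (hh : ContinuousAt h x)
    (hg : ∀ᶠ v in 𝓝 (h x), g (xCoord e L v) = v) (hx : ∀ᶠ y in 𝓝 x, xCoord e L (h y) = y) :
    g =ᶠ[𝓝 x] h := by
  filter_upwards [hh.eventually hg, hx] with y h1 h2
  rwa [h2] at h1

variable (hL : IsLatticeOf L e)
include hL

lemma IsAbelBranch.eventually_xCoord_eq {Q : AffineCurve e} {w : ℂ → ℂ}
    (hw : IsAbelBranch e Q w) : ∀ᶠ x in 𝓝 Q.1.1, xCoord e L (w x) = x := by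
  filter_upwards [hw.2.2] with x ⟨R, hR, hRw⟩
  rw [isAbelValue_iff hL, toCurve_eq_coe_iff] at hRw
  rw [hRw.2.1, hR]

/-- A function of `u` is continued along a cycle by adding the period of the cycle to `u`. -/
lemma continuesAlong_of_isCycle {c : ℝ → AffineCurve e} (hc : IsCycle c)
    {F : ℂ → Matrix (Fin 2) (Fin 2) ℂ}
    (hF : ∀ s ∈ Icc (0 : ℝ) 1, ∀ u, toCurve hL u = c s →
      ∀ i j, AnalyticAt ℂ (fun v ↦ F v i j) u) {w : ℂ → ℂ} (hw : IsAbelBranch e (c 0) w) :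
    ContinuesAlong (fun s ↦ (c s).1.1) (fun x ↦ F (w x))
      (fun x ↦ F (w x + abelIntegral c 0 1)) := by
  obtain ⟨z, hz, hzc, hz0, hz1⟩ := exists_lift_of_isCycle_of_eq hL hc ((isAbelValue_iff hL).1 hw.2.1)
  have hwx := hw.eventually_xCoord_eq hL
  have hω : abelIntegral c 0 1 ∈ L.lattice := by
    have h1 : toCurve hL (z 1) = toCurve hL (z 0) := by
      rw [hzc 0 (by simp), hzc 1 (by simp), hc.2.2.2]
    rwa [toCurve_eq_iff, hz1, hz0, add_sub_cancel_left] at h1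
  have hzX : ∀ s ∈ Icc (0 : ℝ) 1, xCoord e L (z s) = (c s).1.1 := fun s hs ↦
    ((toCurve_eq_coe_iff hL).1 (hzc s hs)).2.1
  -- The continued germ at time `s` is `F` composed with the local inverse of `x` that takes the
  -- value `z s`. Nearby local inverses agree, since the lift `z` is continuous.
  have hloc : ∀ s ∈ Icc (0 : ℝ) 1, ∃ g : ℂ → ℂ, AnalyticAt ℂ g (c s).1.1 ∧
      (∀ᶠ v in 𝓝 (z s), g (xCoord e L v) = v) ∧ ∀ᶠ x in 𝓝 (c s).1.1, xCoord e L (g x) = x := by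
    intro s hs
    obtain ⟨h1, -, h3⟩ := (toCurve_eq_coe_iff hL).1 (hzc s hs)
    rw [← hzX s hs]
    exact exists_localInverse_xCoord h1 (h3 ▸ hc.2.2.1 s hs)
  choose! g hga hgl hgr using hloc
  have hgz : ∀ s ∈ Icc (0 : ℝ) 1, g s (c s).1.1 = z s := fun s hs ↦ by
    rw [← hzX s hs]
    exact (hgl s hs).self_of_nhds
  have hx : ContinuousOn (fun s ↦ (c s).1.1) (Icc 0 1) := hc.2.1.continuousOn
  refine ⟨fun s x ↦ F (g s x), fun s hs i j ↦ ?_, fun s hs ↦ ?_, ?_, ?_⟩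
  · have h1 := hF s hs (z s) (hzc s hs) i j
    rw [← hgz s hs] at h1
    exact h1.comp (hga s hs)
  · have hxs := hx s hs
    filter_upwards [self_mem_nhdsWithin, hxs.eventually (hga s hs).eventually_analyticAt,
      hxs.eventually (hgr s hs).eventually_nhds, (hz s hs).eventually (hgl s hs)]
      with r hr h1 h2 h3
    rw [hzX r hr] at h3
    have h4 := eventuallyEq_localInverse h1.continuousAt (by rw [h3]; exact hgl r hr) h2
    filter_upwards [h4] with x hx
    rw [hx]
  · have h0 : (0 : ℝ) ∈ Icc (0 : ℝ) 1 := by simp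
    filter_upwards [eventuallyEq_localInverse hw.1.continuousAt
      (by rw [← hz0]; exact hgl 0 h0) hwx] with x hx
    rw [hx]
  · have h1 : (1 : ℝ) ∈ Icc (0 : ℝ) 1 := by simp
    -- As `x` is `Λ`-periodic, the branch `w` plus the period is also a right inverse of `x`, and
    -- its value at the end point is `z 1`; it is therefore the final local inverse.
    have h2 : ContinuousAt (fun x ↦ w x + abelIntegral c 0 1) (c 1).1.1 := by
      rw [← hc.2.2.2]
      exact hw.1.continuousAt.add continuousAt_const
    filter_upwards [eventuallyEq_localInverse h2
      (by simp only [← hc.2.2.2]; rw [← hz1]; exact hgl 1 h1) (by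
        simp only [← hc.2.2.2]
        filter_upwards [hwx] with x hx
        rw [xCoord_add hω, hx])] with x hx
    rw [hx]

/-- The poles `±α + Λ` are the values of the Abel map at the points above `a`. -/
lemma sub_notMem_and_add_notMem {a α u : ℂ} (hα : LiesOver (toCurve hL α) a)
    (hu : ¬ LiesOver (toCurve hL u) a) : u - α ∉ L.lattice ∧ u + α ∉ L.lattice := by
  rw [liesOver_toCurve_iff] at hα hu
  obtain ⟨hα, rfl⟩ := hα
  by_cases hul : u ∈ L.lattice
  · exact ⟨fun h ↦ hα (by simpa using L.lattice.sub_mem hul h),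
      fun h ↦ hα (by simpa using L.lattice.sub_mem h hul)⟩
  · have h1 : ¬ xCoord e L u = xCoord e L α := fun h ↦ hu ⟨hul, h⟩
    rw [xCoord_eq_iff hul hα, not_or] at h1
    exact h1.symm

/-- A function of `u` that is multiplied by a factor under `u ↦ u + ω` is multiplied by this factor
under continuation along the cycles of period `ω`. -/
lemma continuesAlong_of_isCycle_of_add {c : ℝ → AffineCurve e} (hc : IsCycle c) {a : ℂ}
    (hca : ∀ s ∈ Icc (0 : ℝ) 1, (c s).1.1 ≠ a) {F G : ℂ → Matrix (Fin 2) (Fin 2) ℂ}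
    (hF : ∀ u, ¬ LiesOver (toCurve hL u) a → ∀ i j, AnalyticAt ℂ (fun v ↦ F v i j) u)
    (hG : ∀ u, ¬ LiesOver (toCurve hL u) a → F (u + abelIntegral c 0 1) = G u)
    {w : ℂ → ℂ} (hw : IsAbelBranch e (c 0) w) :
    ContinuesAlong (fun s ↦ (c s).1.1) (fun x ↦ F (w x)) (fun x ↦ G (w x)) := by
  obtain ⟨f, h1, h2, h3, h4⟩ := continuesAlong_of_isCycle hL hc (F := F)
    (fun s hs u hu ↦ hF u (by
      rw [liesOver_toCurve_iff]
      rintro ⟨-, h⟩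
      exact hca s hs (((toCurve_eq_coe_iff hL).1 hu).2.1.symm.trans h))) hw
  refine ⟨f, h1, h2, h3, h4.trans ?_⟩
  have h5 : ∀ᶠ x in 𝓝 (c 1).1.1, x ≠ a := isOpen_ne.mem_nhds (hca 1 (by simp))
  have h6 := hw.eventually_xCoord_eq hL
  rw [hc.2.2.2] at h6
  filter_upwards [h5, h6] with x h5 h6
  refine hG _ ?_
  rw [liesOver_toCurve_iff, h6]
  exact fun h ↦ h5 h.2

omit hL in
lemma exists_two_mul_notMem (α : ℂ) :
    ∃ u, 2 * u ∉ L.lattice ∧ u - α ∉ L.lattice ∧ u + α ∉ L.lattice := by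
  have h1 : ({u : ℂ | 2 * u ∈ L.lattice} ∪
      ({u : ℂ | u - α ∈ L.lattice} ∪ {u : ℂ | u + α ∈ L.lattice})).Countable :=
    ((countable_lattice L).preimage (mul_right_injective₀ (two_ne_zero' ℂ))).union
      (((countable_lattice L).preimage (sub_left_injective (b := α))).union
        ((countable_lattice L).preimage (add_left_injective α)))
  obtain ⟨u, hu⟩ := (h1.dense_compl ℂ).nonempty
  simp only [mem_compl_iff, mem_union, not_or] at hu
  exact ⟨u, hu⟩

end Continuation

end EllipticRH

/-! ### Proof of the theorem -/

theorem mainTheorem5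
    (e : Fin 3 → ℂ) (he : Function.Injective e)
    (L : PeriodPair) (hL : EllipticRH.IsLatticeOf L e) (hIm : 0 < (L.ω₂ / L.ω₁).im)
    (p q t : ℂ)
    (a α : ℂ) (ha : ∀ i, a ≠ e i)
    (Pa : EllipticRH.Curve e) (hPa : EllipticRH.LiesOver Pa a)
    (hα : EllipticRH.IsAbelValue e Pa α)
    (Pφ Pψ : EllipticRH.Curve e) (uφ uψ : ℂ)
    (hφ : EllipticRH.IsAbelValue e Pφ uφ) (hψ : EllipticRH.IsAbelValue e Pψ uψ) :
    -- `Λ = ℤ ω₁ + ℤ ω₂` is the lattice of the periods of `dx / y` along cycles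
    {ω | ∃ c : ℝ → EllipticRH.AffineCurve e, EllipticRH.IsCycle c ∧
      (∀ s ∈ Set.Icc (0 : ℝ) 1, (c s).1.1 ≠ a) ∧ EllipticRH.abelIntegral c 0 1 = ω} =
        (L.lattice : Set ℂ) ∧
    -- `Φ` is holomorphic outside of the points above `a`
    (∀ P u, EllipticRH.IsAbelValue e P u → ¬ EllipticRH.LiesOver P a →
      ∀ i j, AnalyticAt ℂ (fun v => EllipticRH.Phi L p q t α uφ uψ v i j) u) ∧
    -- the continuation of `Φ` along the cycles of period `ω₁`
    (∀ c : ℝ → EllipticRH.AffineCurve e, EllipticRH.IsCycle c →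
      (∀ s ∈ Set.Icc (0 : ℝ) 1, (c s).1.1 ≠ a) → EllipticRH.abelIntegral c 0 1 = L.ω₁ →
      ∀ w, EllipticRH.IsAbelBranch e (c 0) w →
        EllipticRH.ContinuesAlong (fun s => (c s).1.1)
          (fun x => EllipticRH.Phi L p q t α uφ uψ (w x))
          (fun x => Complex.exp (EllipticRH.eta₁ L * (2 * w x + L.ω₁)) •
            (EllipticRH.Phi L p q t α uφ uψ (w x) *
              !![Complex.exp (Real.pi * Complex.I * (2 * p + 1)), 0;
                 0, Complex.exp (-(Real.pi * Complex.I * (2 * p + 1)))]))) ∧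
    -- the continuation of `Φ` along the cycles of period `ω₂`
    (∀ c : ℝ → EllipticRH.AffineCurve e, EllipticRH.IsCycle c →
      (∀ s ∈ Set.Icc (0 : ℝ) 1, (c s).1.1 ≠ a) → EllipticRH.abelIntegral c 0 1 = L.ω₂ →
      ∀ w, EllipticRH.IsAbelBranch e (c 0) w →
        EllipticRH.ContinuesAlong (fun s => (c s).1.1)
          (fun x => EllipticRH.Phi L p q t α uφ uψ (w x))
          (fun x => Complex.exp (EllipticRH.eta₂ L * (2 * w x + L.ω₂)) •
            (EllipticRH.Phi L p q t α uφ uψ (w x) *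
              !![Complex.exp (-(Real.pi * Complex.I * (2 * q + 1))), 0;
                 0, Complex.exp (Real.pi * Complex.I * (2 * q + 1))]))) ∧
    -- `det Φ` does not vanish identically if and only if the parameters are generic
    ((∃ P u, EllipticRH.IsAbelValue e P u ∧ ¬ EllipticRH.LiesOver P a ∧
        (EllipticRH.Phi L p q t α uφ uψ u).det ≠ 0) ↔
      Pφ ≠ Pψ ∧ EllipticRH.sigmaChar L p q t ≠ 0 ∧
        EllipticRH.sigmaChar L p q (uφ + uψ + t) ≠ 0) ∧
    -- and then `Φ` is invertible outside of the branch points, and the holomorphic extension `D`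
    -- of `det Φ` has exactly four zeros on the curve, the branch points, all of them simple
    (Pφ ≠ Pψ → EllipticRH.sigmaChar L p q t ≠ 0 →
      EllipticRH.sigmaChar L p q (uφ + uψ + t) ≠ 0 →
      (∀ P u, EllipticRH.IsAbelValue e P u → ¬ EllipticRH.LiesOver P a →
        P ∉ EllipticRH.branchPoints e → IsUnit (EllipticRH.Phi L p q t α uφ uψ u)) ∧
      ∃ D : ℂ → ℂ, Differentiable ℂ D ∧
        (∀ P u, EllipticRH.IsAbelValue e P u → ¬ EllipticRH.LiesOver P a →
          D u = (EllipticRH.Phi L p q t α uφ uψ u).det) ∧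
        {P | ∃ u, EllipticRH.IsAbelValue e P u ∧ D u = 0} = EllipticRH.branchPoints e ∧
        (EllipticRH.branchPoints e).ncard = 4 ∧
        (∀ P u, EllipticRH.IsAbelValue e P u →
          (P ∈ EllipticRH.branchPoints e → analyticOrderAt D u = 1) ∧
          (P ∉ EllipticRH.branchPoints e → D u ≠ 0))) := by
  have hval {P : EllipticRH.Curve e} {u : ℂ} :
      EllipticRH.IsAbelValue e P u ↔ EllipticRH.toCurve hL u = P := EllipticRH.isAbelValue_iff hL
  rw [hval] at hα hφ hψ
  subst hα hφ hψ
  have hpole := fun u ↦ EllipticRH.sub_notMem_and_add_notMem hL (u := u) hPa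
  have hF : ∀ u, ¬ EllipticRH.LiesOver (EllipticRH.toCurve hL u) a → ∀ i j,
      AnalyticAt ℂ (fun v ↦ EllipticRH.Phi L p q t α uφ uψ v i j) u := fun u hu ↦
    EllipticRH.analyticAt_Phi hIm (hpole u hu).1 (hpole u hu).2
  have hdet := EllipticRH.det_Phi hIm p q t α uφ uψ
  have hne : EllipticRH.toCurve hL uφ ≠ EllipticRH.toCurve hL uψ ↔
      EllipticRH.sigma L (uφ - uψ) ≠ 0 := by
    rw [Ne, Ne, EllipticRH.toCurve_eq_iff, EllipticRH.sigma_eq_zero_iff]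
  refine ⟨EllipticRH.periods_eq hL a, ?_, ?_, ?_, ?_, ?_⟩
  · intro P u hu
    rw [hval] at hu
    subst hu
    exact hF u
  · intro c hc hca hcω w hw
    refine EllipticRH.continuesAlong_of_isCycle_of_add hL hc hca hF
      (G := fun u ↦ Complex.exp (EllipticRH.eta₁ L * (2 * u + L.ω₁)) •
        (EllipticRH.Phi L p q t α uφ uψ u *
          !![Complex.exp (Real.pi * Complex.I * (2 * p + 1)), 0;
            0, Complex.exp (-(Real.pi * Complex.I * (2 * p + 1)))]))
      (fun u hu ↦ ?_) hw
    rw [hcω]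
    exact EllipticRH.Phi_add_ω₁ (hpole u hu).1 (hpole u hu).2
  · intro c hc hca hcω w hw
    refine EllipticRH.continuesAlong_of_isCycle_of_add hL hc hca hF
      (G := fun u ↦ Complex.exp (EllipticRH.eta₂ L * (2 * u + L.ω₂)) •
        (EllipticRH.Phi L p q t α uφ uψ u *
          !![Complex.exp (-(Real.pi * Complex.I * (2 * q + 1))), 0;
            0, Complex.exp (Real.pi * Complex.I * (2 * q + 1))]))
      (fun u hu ↦ ?_) hw
    rw [hcω]
    exact EllipticRH.Phi_add_ω₂ hIm (hpole u hu).1 (hpole u hu).2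
  · rw [hne]
    constructor
    · rintro ⟨P, u, -, -, h⟩
      rw [hdet] at h
      have h1 := left_ne_zero_of_mul h
      have h2 := left_ne_zero_of_mul h1
      exact ⟨right_ne_zero_of_mul h1, left_ne_zero_of_mul h2, right_ne_zero_of_mul h2⟩
    · rintro ⟨h1, h2, h3⟩
      -- A point that is neither a half-period nor above `a`; there `σ(2u) ≠ 0`.
      obtain ⟨u, hu, hu1, hu2⟩ := EllipticRH.exists_two_mul_notMem (L := L) α
      refine ⟨_, u, hval.2 rfl, ?_, ?_⟩
      · obtain ⟨hαl, hαa⟩ := (EllipticRH.liesOver_toCurve_iff hL).1 hPa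
        rw [EllipticRH.liesOver_toCurve_iff, ← hαa]
        rintro ⟨hul, h⟩
        exact ((EllipticRH.xCoord_eq_iff hul hαl).1 h).elim hu2 hu1
      · rw [hdet]
        exact mul_ne_zero (mul_ne_zero (mul_ne_zero h2 h3) h1)
          (mt (EllipticRH.sigma_eq_zero_iff L).1 hu)
  · intro h1 h2 h3
    rw [hne] at h1
    have hC := mul_ne_zero (mul_ne_zero h2 h3) h1
    have hD : ∀ u, EllipticRH.sigmaChar L p q t * EllipticRH.sigmaChar L p q (uφ + uψ + t) *
        EllipticRH.sigma L (uφ - uψ) * EllipticRH.sigma L (2 * u) = 0 ↔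
        EllipticRH.toCurve hL u ∈ EllipticRH.branchPoints e := by
      intro u
      rw [EllipticRH.toCurve_mem_branchPoints_iff, mul_eq_zero, or_iff_right hC,
        EllipticRH.sigma_eq_zero_iff]
    have hderiv := fun u ↦ (EllipticRH.hasDerivAt_sigma_two_mul L u).const_mul
      (EllipticRH.sigmaChar L p q t * EllipticRH.sigmaChar L p q (uφ + uψ + t) *
        EllipticRH.sigma L (uφ - uψ))
    -- The extension `D`, left to unification, is the right-hand side of `det_Phi`, a nonzero
    -- constant times `σ(2u)`.
    refine ⟨fun P u hu _ hP ↦ ?_, _, fun u ↦ (hderiv u).differentiableAt,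
      fun P u _ _ ↦ (hdet u).symm, ?_, EllipticRH.ncard_branchPoints he, fun P u hu ↦ ?_⟩
    · rw [hval] at hu
      subst hu
      rw [Matrix.isUnit_iff_isUnit_det, isUnit_iff_ne_zero, hdet]
      exact mt (hD u).1 hP
    · ext P
      constructor
      · rintro ⟨u, hu, h⟩
        rw [hval] at hu
        subst hu
        exact (hD u).1 h
      · intro hP
        obtain ⟨u, rfl⟩ := EllipticRH.exists_toCurve_eq hL P
        exact ⟨u, hval.2 rfl, (hD u).2 hP⟩
    · rw [hval] at hu
      subst hu
      refine ⟨fun hP ↦ ?_, mt (hD u).1⟩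
      refine AnalyticAt.analyticOrderAt_eq_one_of_zero_deriv_ne_zero ?_ ((hD u).2 hP) ?_
      · exact Differentiable.analyticAt (fun u ↦ (hderiv u).differentiableAt) u
      · rw [(hderiv u).deriv]
        exact mul_ne_zero hC (mul_ne_zero two_ne_zero (EllipticRH.deriv_sigma_ne_zero L
          ((EllipticRH.toCurve_mem_branchPoints_iff hL).1 hP)))
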